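/- A simple polygon is a closed polygon in the Euclidean plane with $h\ge 3$ pairwise distinct vertices, in which cyclically consecutive edges meet only in their common vertex and all other pairs of distinct edges are disjoint. Its boundary is the union of its edges; a point off the boundary is inside (resp. outside) the polygon if its connected component in the complement of the boundary is bounded (resp. unbounded). Let $\beta\ge 0$ be a real number. A simple polygon $P$ is a planar-$\beta$-star if there is a nonempty open set $K$ inside $P$ such that for every point $p\in K$ there are polylines $c(v)$, one for each vertex $v$ of $P$, such that $c(v)$ goes from $v$ to $p$, has at most $\beta$ bends, and lies inside $P$ except for its starting point $v$, and such that $c(v)\cap c(v')=\{p\}$ for any two distinct vertices $v,v'$. A simple polygon $P$ is a planar-$\beta$-outer-star if there are infinite polylines $c(v)$, one for each vertex $v$ of $P$, such that $c(v)$ starts at $v$, has at most $\beta$ bends, ends with a ray, and lies outside $P$ except for its starting point $v$, and such that $c(v)\cap c(v')=\emptyset$ for any two distinct vertices $v,v'$. Then every simple polygon with $h$ vertices is both a planar-$\frac{h-2}{2}$-star and a planar-$\frac{h-2}{2}$-outer-star. -/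

import Mathlib

namespace PlanarStar

/-- The Euclidean plane. -/
abbrev Plane : Type := EuclideanSpace ℝ (Fin 2)

/-- `P` is a simple polygon: it has at least three vertices, the vertices are pairwise distinct,
cyclically consecutive edges meet only in their common vertex, and all other pairs of distinct
edges are disjoint. (Three consecutive vertices may be collinear.) -/
structure IsSimplePolygon {n : ℕ} (P : Polygon Plane n) : Prop where
  three_le : 3 ≤ n
  injective : Function.Injective P.vertices
  consecutive : ∀ i : Fin n,
    P.edgeSet ℝ i ∩ P.edgeSet ℝ (finRotate n i) = {P (finRotate n i)}
  nonconsecutive : ∀ i j : Fin n, i ≠ j → j ≠ finRotate n i → i ≠ finRotate n j →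
    Disjoint (P.edgeSet ℝ i) (P.edgeSet ℝ j)

/-- The (open) inside of a polygon: the points off the boundary whose connected component in the
complement of the boundary is bounded. -/
def inside {n : ℕ} (P : Polygon Plane n) : Set Plane :=
  {x | x ∉ P.boundary ℝ ∧ Bornology.IsBounded (connectedComponentIn (P.boundary ℝ)ᶜ x)}

/-- The (open) outside of a polygon: the points off the boundary whose connected component in the
complement of the boundary is unbounded. -/
def outside {n : ℕ} (P : Polygon Plane n) : Set Plane :=
  {x | x ∉ P.boundary ℝ ∧ ¬ Bornology.IsBounded (connectedComponentIn (P.boundary ℝ)ᶜ x)}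

/-- The point set of the polyline that starts at `a`, bends at the listed points in the given
order, and ends at `p`. Its number of bends is the length of the list. -/
def polyline : Plane → List Plane → Plane → Set Plane
  | a, [], p => segment ℝ a p
  | a, b :: l, p => segment ℝ a b ∪ polyline b l p

/-- The point set of the infinite polyline that starts at `a`, bends at the listed points in the
given order, and after the last bend (or from `a`, if there is none) continues as a ray in
direction `d`. Its number of bends is the length of the list. -/
def infinitePolyline : Plane → List Plane → Plane → Set Plane
  | a, [], d => {x | ∃ t : ℝ, 0 ≤ t ∧ x = a + t • d}
  | a, b :: l, d => segment ℝ a b ∪ infinitePolyline b l d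

/-- A (simple) polygon `P` is a planar-`β`-star: there is a nonempty open kernel `K` inside `P`
such that for every point `p` of `K` the vertices can be joined to `p` by polylines with at most
`β` bends each, which run inside `P` (and touch `P` only at their starting vertices) and any two
of which share only the point `p`. -/
def IsPlanarStar {n : ℕ} (P : Polygon Plane n) (β : ℝ) : Prop :=
  ∃ K : Set Plane, IsOpen K ∧ K.Nonempty ∧ K ⊆ inside P ∧
    ∀ p ∈ K, ∃ bends : Fin n → List Plane,
      (∀ i, ((bends i).length : ℝ) ≤ β) ∧
      (∀ i, polyline (P i) (bends i) p \ {P i} ⊆ inside P) ∧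
      (∀ i j, i ≠ j → polyline (P i) (bends i) p ∩ polyline (P j) (bends j) p = {p})

/-- A (simple) polygon `P` is a planar-`β`-outer-star: from the vertices one can draw infinite
polylines with at most `β` bends each, which run outside `P` (and touch `P` only at their starting
vertices) and are pairwise disjoint. -/
def IsPlanarOuterStar {n : ℕ} (P : Polygon Plane n) (β : ℝ) : Prop :=
  ∃ (bends : Fin n → List Plane) (dir : Fin n → Plane),
    (∀ i, dir i ≠ 0) ∧
    (∀ i, ((bends i).length : ℝ) ≤ β) ∧
    (∀ i, infinitePolyline (P i) (bends i) (dir i) \ {P i} ⊆ outside P) ∧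
    (∀ i j, i ≠ j → Disjoint (infinitePolyline (P i) (bends i) (dir i))
      (infinitePolyline (P j) (bends j) (dir j)))

end PlanarStar

/-!
Three vertices suffice to get started: for the inner star, every point `p` inside the polygon sees
three vertices (`exists_three_visible`), so that straight segments to `p` will do; for the outer
star, the convex hull has three extreme vertices, and the rays from these that run away from a fixed
point `q` of the hull are disjoint and avoid the polygon (`exists_three_outward`). In both cases the
rest of the construction is the same. The set of drawn polylines is extended vertex by vertex along
the polygon: if `v'` has its polyline and its neighbour `v` has none, the polyline of `v` runs
alongside the edge from `v` to `v'` and then alongside the polyline of `v'`, so close to them that it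
meets nothing else (`Finish.exists_detached_path`, `Finish.IsDrawing.exists_insert`). This costs one
bend more than `v'` has. A vertex at cyclic distance `d` from the three initial ones thus gets `d`
bends, and `d ≤ (h - 2) / 2`, since an arc of `2 * d - 1` vertices around it contains none of the
three (`Finish.exists_isDrawing_univ`).

The new polyline is obtained from the old one by moving its corners `b` off the old position one
after the other. At such a corner only three directions matter, namely those of the two pieces of the
polyline and that of one more segment, and `b` is moved into the sector between the first two that
does not contain the third (`exists_bisecting_direction`). All other obstacles are avoided because
the move is small: an obstacle that meets a segment at most in one endpoint still does so after the
other endpoint has been moved slightly (`Tame`).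

That three vertices are visible from `p` follows from the fact that each open half-plane at `p`
contains one (`exists_visible_vertex`). That there are points inside at all follows from the winding
number: it vanishes on unbounded components, and it jumps by one when the midpoint of an edge is
crossed (`inside_nonempty`).
-/

namespace PlanarStar

open Set Filter Topology

/-! ### Segments, rays and directions in the plane -/

lemma mem_segment_iff_exists_smul_sub {a b z : Plane} :
    z ∈ segment ℝ a b ↔ ∃ t : ℝ, 0 ≤ t ∧ t ≤ 1 ∧ z = a + t • (b - a) := by
  rw [segment_eq_image']
  constructor
  · rintro ⟨t, ⟨h0, h1⟩, rfl⟩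
    exact ⟨t, h0, h1, rfl⟩
  · rintro ⟨t, h0, h1, rfl⟩
    exact ⟨t, ⟨h0, h1⟩, rfl⟩

lemma isClosed_segment (a b : Plane) : IsClosed (segment ℝ a b) := by
  rw [← convexHull_pair]
  exact ((Set.toFinite {a, b}).isCompact_convexHull (𝕜 := ℝ)).isClosed

lemma isCompact_segment (a b : Plane) : IsCompact (segment ℝ a b) := by
  rw [← convexHull_pair]
  exact (Set.toFinite {a, b}).isCompact_convexHull (𝕜 := ℝ)

lemma isClosed_smul_nonneg (v : Plane) : IsClosed {z : Plane | ∃ t : ℝ, 0 ≤ t ∧ z = t • v} := by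
  by_cases hv : v = 0
  · have : {z : Plane | ∃ t : ℝ, 0 ≤ t ∧ z = t • v} = {0} := by
      ext z
      simp only [hv, smul_zero, mem_ofPred_eq, mem_singleton_iff]
      exact ⟨fun ⟨t, _, h⟩ => h, fun h => ⟨0, le_rfl, h⟩⟩
    rw [this]
    exact isClosed_singleton
  · have h := (isClosedEmbedding_smul_left (𝕜 := ℝ) hv).isClosedMap _ (isClosed_Ici (a := (0 : ℝ)))
    convert h using 1
    ext z
    simp only [mem_ofPred_eq, mem_image, mem_Ici]
    exact ⟨fun ⟨t, h, e⟩ => ⟨t, h, e.symm⟩, fun ⟨t, h, e⟩ => ⟨t, h, e.symm⟩⟩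

/-- Two vectors of the plane are either linearly dependent or a basis, in coordinates. -/
lemma eq_smul_or_basis (γ α : Plane) (hγ : γ ≠ 0) :
    (∃ k : ℝ, α = k • γ) ∨ ((∀ ω : Plane, ∃ x y : ℝ, ω = x • γ + y • α) ∧
      ∀ x y : ℝ, x • γ + y • α = 0 → x = 0 ∧ y = 0) := by
  by_cases h : ∃ k : ℝ, α = k • γ
  · exact Or.inl h
  · right
    have hli : LinearIndependent ℝ ![γ, α] := by
      rw [LinearIndependent.pair_iff' hγ]
      intro k hk
      exact h ⟨k, hk.symm⟩
    constructor
    · intro ω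
      have hspan : Submodule.span ℝ (Set.range ![γ, α]) = ⊤ :=
        hli.span_eq_top_of_card_eq_finrank (by simp)
      have hω : ω ∈ Submodule.span ℝ (Set.range ![γ, α]) := by rw [hspan]; trivial
      rw [Matrix.range_cons, Matrix.range_cons, Matrix.range_empty, union_empty,
        Set.singleton_union, Submodule.mem_span_pair] at hω
      obtain ⟨x, y, e⟩ := hω
      exact ⟨x, y, e.symm⟩
    · exact fun x y e => LinearIndependent.pair_iff.1 hli x y e

/-- Given three directions at a point, no two of them on a common ray, there is a direction `u`
such that the sectors spanned by `u` and `α` and by `u` and `γ` miss the three given rays (except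
along their own sides) and overlap only in the ray of `u`: it bisects the sector between `α` and
`γ` that does not contain `ω`. -/
lemma exists_bisecting_direction {α γ ω : Plane} (hα : α ≠ 0) (hγ : γ ≠ 0)
    (hαγ : ∀ t : ℝ, 0 < t → α ≠ t • γ) (hαω : ∀ t : ℝ, 0 < t → ω ≠ t • α)
    (hγω : ∀ t : ℝ, 0 < t → ω ≠ t • γ) (hω : ω ≠ 0) :
    ∃ u : Plane,
      (∀ l m t : ℝ, 0 ≤ l → 0 < m → 0 ≤ t →
        l • α + m • u ≠ t • α ∧ l • α + m • u ≠ t • γ ∧ l • α + m • u ≠ t • ω) ∧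
      (∀ l m t : ℝ, 0 ≤ l → 0 < m → 0 ≤ t →
        l • γ + m • u ≠ t • α ∧ l • γ + m • u ≠ t • γ ∧ l • γ + m • u ≠ t • ω) ∧
      (∀ l m l' m' : ℝ, 0 ≤ l → 0 ≤ l' → l • α + m • u = l' • γ + m' • u → l = 0) := by
  rcases eq_smul_or_basis γ α hγ with ⟨k, hk⟩ | ⟨hb, hi⟩
  · -- `α` and `γ` are opposite: leave through the side away from `ω`
    have hk0 : k < 0 := by
      rcases lt_trichotomy k 0 with h | h | h
      · exact h
      · exact absurd (by rw [hk, h, zero_smul]) hα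
      · exact absurd hk (hαγ k h)
    have hind : ∀ x y : ℝ, x • γ + y • ω = 0 → x = 0 ∧ y = 0 := by
      rcases eq_smul_or_basis γ ω hγ with ⟨j, hj⟩ | h
      · exfalso
        rcases lt_trichotomy j 0 with h | h | h
        · apply hαω (j / k) (div_pos_of_neg_of_neg h hk0)
          rw [hk, smul_smul, div_mul_cancel₀ _ hk0.ne, hj]
        · exact hω (by rw [hj, h, zero_smul])
        · exact hγω j h hj
      · exact h.2
    subst hk
    refine ⟨-ω, ?_, ?_, ?_⟩
    · intro l m t hl hm ht
      refine ⟨fun e => ?_, fun e => ?_, fun e => ?_⟩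
      · have := hind (l * k - t * k) (-m) (by linear_combination (norm := module) e)
        linarith [this.2]
      · have := hind (l * k - t) (-m) (by linear_combination (norm := module) e)
        linarith [this.2]
      · have := hind (l * k) (-m - t) (by linear_combination (norm := module) e)
        linarith [this.2]
    · intro l m t hl hm ht
      refine ⟨fun e => ?_, fun e => ?_, fun e => ?_⟩
      · have := hind (l - t * k) (-m) (by linear_combination (norm := module) e)
        linarith [this.2]
      · have := hind (l - t) (-m) (by linear_combination (norm := module) e)
        linarith [this.2]
      · have := hind l (-m - t) (by linear_combination (norm := module) e)
        linarith [this.2]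
    · intro l m l' m' hl hl' e
      have := (hind (l * k - l') (-m + m') (by linear_combination (norm := module) e)).1
      by_contra hne
      have : 0 < l := lt_of_le_of_ne hl (Ne.symm hne)
      nlinarith [mul_neg_of_pos_of_neg this hk0]
  · obtain ⟨x, y, rfl⟩ := hb ω
    by_cases hxy : 0 < x ∧ 0 < y
    · -- `ω` lies in the convex sector, so the reflex one is used
      obtain ⟨hx, hy⟩ := hxy
      refine ⟨-(γ + α), ?_, ?_, ?_⟩
      · intro l m t hl hm ht
        have hx' := mul_nonneg ht hx.le
        have hy' := mul_nonneg ht hy.le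
        refine ⟨fun e => ?_, fun e => ?_, fun e => ?_⟩
        · have := hi (-m) (l - m - t) (by linear_combination (norm := module) e)
          linarith [this.1]
        · have := hi (-m - t) (l - m) (by linear_combination (norm := module) e)
          linarith [this.1]
        · have := hi (-m - t * x) (l - m - t * y) (by linear_combination (norm := module) e)
          linarith [this.1]
      · intro l m t hl hm ht
        have hx' := mul_nonneg ht hx.le
        have hy' := mul_nonneg ht hy.le
        refine ⟨fun e => ?_, fun e => ?_, fun e => ?_⟩
        · have := hi (l - m) (- m - t) (by linear_combination (norm := module) e)
          linarith [this.2]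
        · have := hi (l - m - t) (-m) (by linear_combination (norm := module) e)
          linarith [this.2]
        · have := hi (l - m - t * x) (-m - t * y) (by linear_combination (norm := module) e)
          linarith [this.2]
      · intro l m l' m' hl hl' e
        have := hi (-m - l' + m') (l - m + m') (by linear_combination (norm := module) e)
        linarith [this.1, this.2]
    · refine ⟨γ + α, ?_, ?_, ?_⟩
      · intro l m t hl hm ht
        refine ⟨fun e => ?_, fun e => ?_, fun e => ?_⟩
        · have := hi m (l + m - t) (by linear_combination (norm := module) e)
          linarith [this.1]
        · have := hi (m - t) (l + m) (by linear_combination (norm := module) e)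
          linarith [this.2]
        · have := hi (m - t * x) (l + m - t * y) (by linear_combination (norm := module) e)
          apply hxy
          constructor
          · by_contra hx
            nlinarith [this.1]
          · by_contra hy
            nlinarith [this.2]
      · intro l m t hl hm ht
        refine ⟨fun e => ?_, fun e => ?_, fun e => ?_⟩
        · have := hi (l + m) (m - t) (by linear_combination (norm := module) e)
          linarith [this.1]
        · have := hi (l + m - t) m (by linear_combination (norm := module) e)
          linarith [this.2]
        · have := hi (l + m - t * x) (m - t * y) (by linear_combination (norm := module) e)
          apply hxy
          constructor
          · by_contra hx
            nlinarith [this.1]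
          · by_contra hy
            nlinarith [this.2]
      · intro l m l' m' hl hl' e
        have := hi (m - l' - m') (l + m - m') (by linear_combination (norm := module) e)
        linarith [this.1, this.2]

/-- If two sets are star-shaped along the directions `v` and `w` at `b` and meet only in `b`, then
the directions do not span the same ray. -/
lemma ne_smul_of_inter_subset {b v w : Plane} {A B : Set Plane} (hv : v ≠ 0)
    (hA : ∀ t : ℝ, 0 ≤ t → t ≤ 1 → b + t • v ∈ A) (hB : ∀ t : ℝ, 0 ≤ t → t ≤ 1 → b + t • w ∈ B)
    (h : A ∩ B ⊆ {b}) (t : ℝ) (ht : 0 < t) : v ≠ t • w := by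
  intro e
  have hs : 0 < min 1 t⁻¹ := by positivity
  have h1 : b + (min 1 t⁻¹) • v ∈ A := hA _ hs.le (min_le_left _ _)
  have h2 : b + (min 1 t⁻¹) • v ∈ B := by
    have := hB (min 1 t⁻¹ * t) (by positivity) (by
      calc min 1 t⁻¹ * t ≤ t⁻¹ * t := by gcongr; exact min_le_right _ _
        _ = 1 := inv_mul_cancel₀ ht.ne')
    rwa [mul_smul, ← e] at this
  have h3 : b + (min 1 t⁻¹) • v = b := h ⟨h1, h2⟩
  rw [add_eq_left, smul_eq_zero] at h3
  exact h3.elim hs.ne' hv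

/-! ### Obstacles that stay avoided under small perturbations -/

/-- A set `F` is tame if a segment from `a` that meets `F` at most in `a` keeps this property when
its other endpoint is moved slightly. -/
def Tame (F : Set Plane) : Prop :=
  ∀ a b, a ≠ b → F ∩ segment ℝ a b ⊆ {a} → ∀ᶠ y in 𝓝 b, F ∩ segment ℝ a y ⊆ {a}

lemma eventually_inter_segment_eq_empty {F : Set Plane} (hF : IsClosed F) {a b : Plane}
    (h : F ∩ segment ℝ a b = ∅) : ∀ᶠ y in 𝓝 b, F ∩ segment ℝ a y = ∅ := by
  have hK : IsCompact (Icc (0 : ℝ) 1) := isCompact_Icc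
  have key : ∀ᶠ y in 𝓝 b, ∀ t ∈ Icc (0 : ℝ) 1, a + t • (y - a) ∉ F := by
    apply hK.eventually_forall_of_forall_eventually
    intro t ht
    have hc : Continuous fun z : Plane × ℝ => a + z.2 • (z.1 - a) := by fun_prop
    have hm : a + t • (b - a) ∈ Fᶜ := fun hF' => by
      have : a + t • (b - a) ∈ F ∩ segment ℝ a b :=
        ⟨hF', mem_segment_iff_exists_smul_sub.2 ⟨t, ht.1, ht.2, rfl⟩⟩
      rw [h] at this
      exact this
    exact hc.continuousAt.preimage_mem_nhds (hF.isOpen_compl.mem_nhds hm)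
  filter_upwards [key] with y hy
  rw [eq_empty_iff_forall_notMem]
  rintro z ⟨hz, hz'⟩
  obtain ⟨t, h0, h1, rfl⟩ := mem_segment_iff_exists_smul_sub.1 hz'
  exact hy t ⟨h0, h1⟩ hz

/-- A closed set is tame if it is contained, as seen from any of its points, in two rays and contains
initial pieces of both. This covers segments as well as rays. -/
lemma tame_of_two_directions {F : Set Plane} (hF : IsClosed F)
    (h : ∀ a ∈ F, ∃ d₁ d₂ : Plane,
      (∀ x ∈ F, ∃ t : ℝ, 0 ≤ t ∧ (x = a + t • d₁ ∨ x = a + t • d₂)) ∧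
      (∃ r : ℝ, 0 < r ∧ ∀ t : ℝ, 0 ≤ t → t ≤ r → a + t • d₁ ∈ F ∧ a + t • d₂ ∈ F)) :
    Tame F := by
  intro a b hab hFab
  by_cases ha : a ∈ F
  · obtain ⟨d₁, d₂, hsub, r, hr, hloc⟩ := h a ha
    set C : Set Plane :=
      {z | ∃ t : ℝ, 0 ≤ t ∧ z = t • d₁} ∪ {z | ∃ t : ℝ, 0 ≤ t ∧ z = t • d₂}
    have hCc : IsClosed C := (isClosed_smul_nonneg d₁).union (isClosed_smul_nonneg d₂)
    have aux : ∀ d : Plane, (∀ t : ℝ, 0 ≤ t → t ≤ r → a + t • d ∈ F) →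
        ∀ t : ℝ, 0 ≤ t → b - a ≠ t • d := by
      intro d hd t ht e
      have hba : b - a ≠ 0 := sub_ne_zero.2 hab.symm
      have ht0 : 0 < t := lt_of_le_of_ne ht (by rintro rfl; exact hba (by rw [e, zero_smul]))
      have hs : 0 < min 1 (r / t) := by positivity
      have h1 : a + (min 1 (r / t)) • (b - a) ∈ F := by
        rw [e, smul_smul]
        apply hd _ (by positivity)
        calc min 1 (r / t) * t ≤ r / t * t := by gcongr; exact min_le_right _ _
          _ = r := div_mul_cancel₀ _ ht0.ne'
      have h2 := hFab ⟨h1, mem_segment_iff_exists_smul_sub.2 ⟨_, hs.le, min_le_left _ _, rfl⟩⟩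
      rw [mem_singleton_iff, add_eq_left, smul_eq_zero] at h2
      exact h2.elim hs.ne' hba
    have hbC : b - a ∈ Cᶜ := by
      rintro (⟨t, ht, e⟩ | ⟨t, ht, e⟩)
      · exact aux d₁ (fun t h0 h1 => (hloc t h0 h1).1) t ht e
      · exact aux d₂ (fun t h0 h1 => (hloc t h0 h1).2) t ht e
    have hc : Continuous fun y : Plane => y - a := by fun_prop
    filter_upwards [hc.continuousAt.preimage_mem_nhds (hCc.isOpen_compl.mem_nhds hbC)] with y hy
    rintro z ⟨hz, hz'⟩
    obtain ⟨s, hs0, hs1, rfl⟩ := mem_segment_iff_exists_smul_sub.1 hz'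
    rcases hs0.eq_or_lt with rfl | hs
    · simp
    · exfalso
      apply hy
      obtain ⟨t, ht, e | e⟩ := hsub _ hz
      · refine Or.inl ⟨s⁻¹ * t, by positivity, ?_⟩
        rw [mul_smul, ← add_left_cancel e, smul_smul, inv_mul_cancel₀ hs.ne', one_smul]
      · refine Or.inr ⟨s⁻¹ * t, by positivity, ?_⟩
        rw [mul_smul, ← add_left_cancel e, smul_smul, inv_mul_cancel₀ hs.ne', one_smul]
  · have : F ∩ segment ℝ a b = ∅ := by
      rw [eq_empty_iff_forall_notMem]
      rintro z hz
      have := hFab hz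
      rw [mem_singleton_iff] at this
      exact ha (this ▸ hz.1)
    filter_upwards [eventually_inter_segment_eq_empty hF this] with y hy
    rw [hy]
    exact empty_subset _

lemma tame_segment (x y : Plane) : Tame (segment ℝ x y) := by
  refine tame_of_two_directions (isClosed_segment x y) fun a ha => ⟨x - a, y - a, ?_, 1, one_pos, ?_⟩
  · intro z hz
    obtain ⟨s, hs0, hs1, rfl⟩ := mem_segment_iff_exists_smul_sub.1 ha
    obtain ⟨t, ht0, ht1, rfl⟩ := mem_segment_iff_exists_smul_sub.1 hz
    rcases le_total t s with h | h
    · rcases hs0.eq_or_lt with rfl | hs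
      · refine ⟨0, le_rfl, Or.inl ?_⟩
        rw [le_antisymm h ht0]
        module
      · refine ⟨(s - t) / s, div_nonneg (by linarith) hs.le, Or.inl ?_⟩
        have : (s - t) / s * s = s - t := div_mul_cancel₀ _ hs.ne'
        linear_combination (norm := module) this • (y - x)
    · rcases hs1.eq_or_lt with rfl | hs
      · refine ⟨0, le_rfl, Or.inl ?_⟩
        rw [le_antisymm ht1 h]
        module
      · have hs' : 0 < 1 - s := by linarith
        refine ⟨(t - s) / (1 - s), div_nonneg (by linarith) hs'.le, Or.inr ?_⟩
        have : (t - s) / (1 - s) * (1 - s) = t - s := div_mul_cancel₀ _ hs'.ne'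
        linear_combination (norm := module) -this • (y - x)
  · intro t h0 h1
    exact ⟨(convex_segment x y).add_smul_sub_mem ha (left_mem_segment ℝ x y) ⟨h0, h1⟩,
      (convex_segment x y).add_smul_sub_mem ha (right_mem_segment ℝ x y) ⟨h0, h1⟩⟩

/-- The ray that starts at `y` and runs away from `q`. -/
def outwardRay (q y : Plane) : Set Plane := {z | ∃ s : ℝ, 1 ≤ s ∧ z = q + s • (y - q)}

lemma isClosed_outwardRay (q y : Plane) : IsClosed (outwardRay q y) := by
  have hc : Continuous fun z : Plane => z - y := by fun_prop
  convert (isClosed_smul_nonneg (y - q)).preimage hc using 1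
  ext z
  constructor
  · rintro ⟨s, hs, rfl⟩
    exact ⟨s - 1, by linarith, by module⟩
  · rintro ⟨t, ht, e⟩
    exact ⟨1 + t, by linarith, by linear_combination (norm := module) e⟩

lemma tame_outwardRay (q y : Plane) : Tame (outwardRay q y) := by
  refine tame_of_two_directions (isClosed_outwardRay q y) ?_
  rintro _ ⟨s, hs, rfl⟩
  refine ⟨y - (q + s • (y - q)), y - q, ?_, 1, one_pos, ?_⟩
  · rintro _ ⟨t, ht, rfl⟩
    rcases le_total s t with h | h
    · exact ⟨t - s, by linarith, Or.inr (by module)⟩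
    · rcases hs.eq_or_lt with rfl | hs'
      · refine ⟨0, le_rfl, Or.inl ?_⟩
        rw [le_antisymm h ht]
        module
      · have hs1 : 0 < s - 1 := by linarith
        refine ⟨(s - t) / (s - 1), div_nonneg (by linarith) hs1.le, Or.inl ?_⟩
        have : (s - t) / (s - 1) * (s - 1) = s - t := div_mul_cancel₀ _ hs1.ne'
        linear_combination (norm := module) this • (y - q)
  · intro t h0 h1
    refine ⟨⟨s - t * (s - 1), by nlinarith, by module⟩, ⟨s + t, by linarith, by module⟩⟩

/-! ### Final pieces of the polylines -/

/-- What the construction needs to know about the last pieces of the polylines, which are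
segments to the kernel point for the inner star and rays for the outer star. A polyline whose last
bend is `y` ends with the set `tail y`, which leaves `y` in direction `dir y`. Different polylines
may share the points of `meet` only. The point `center` is never used as a bend. -/
structure Finish where
  /-- The last piece of a polyline whose last bend is the given point. -/
  tail : Plane → Set Plane
  /-- The points that different polylines may share. -/
  meet : Set Plane
  /-- The kernel point, or the point that the rays run away from. -/
  center : Plane
  /-- The direction in which the last piece leaves its starting point. -/
  dir : Plane → Plane
  dir_ne_zero : ∀ b, b ≠ center → dir b ≠ 0
  meet_subset_center : meet ⊆ {center}
  meet_subset_tail : ∀ b, meet ⊆ tail b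
  exists_of_mem_tail : ∀ b, ∀ z ∈ tail b, ∃ m : ℝ, 0 ≤ m ∧ z = b + m • dir b
  add_smul_mem_tail : ∀ b, ∀ t : ℝ, 0 ≤ t → t ≤ 1 → b + t • dir b ∈ tail b
  mem_tail_add_smul : ∀ (b u : Plane) (ε : ℝ), 0 < ε → ∀ z ∈ tail (b + ε • u),
    z ∈ meet ∨ ∃ l m : ℝ, 0 ≤ l ∧ 0 < m ∧ z = b + (l • dir b + m • u)
  tame_tail : ∀ b, Tame (tail b)
  eventually_segment : ∀ x y b, b ≠ center → segment ℝ x y ∩ tail b ⊆ meet →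
    ∀ᶠ c in 𝓝 b, segment ℝ x y ∩ tail c ⊆ meet
  eventually_tail : ∀ x b, b ≠ center → tail x ∩ tail b ⊆ meet →
    ∀ᶠ c in 𝓝 b, tail x ∩ tail c ⊆ meet

/-- The finish whose last pieces are the segments to the point `c`. -/
def inwardFinish (c : Plane) : Finish where
  tail y := segment ℝ y c
  meet := {c}
  center := c
  dir y := c - y
  dir_ne_zero b hb := sub_ne_zero.2 hb.symm
  meet_subset_center := subset_rfl
  meet_subset_tail b := singleton_subset_iff.2 (right_mem_segment ℝ b c)
  exists_of_mem_tail b z hz := by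
    obtain ⟨t, h0, -, e⟩ := mem_segment_iff_exists_smul_sub.1 hz
    exact ⟨t, h0, e⟩
  add_smul_mem_tail b t h0 h1 := mem_segment_iff_exists_smul_sub.2 ⟨t, h0, h1, rfl⟩
  mem_tail_add_smul b u ε hε z hz := by
    obtain ⟨t, h0, h1, rfl⟩ := mem_segment_iff_exists_smul_sub.1 hz
    rcases h1.eq_or_lt with rfl | h
    · left
      rw [mem_singleton_iff]
      module
    · exact Or.inr ⟨t, ε * (1 - t), h0, mul_pos hε (by linarith), by module⟩
  tame_tail b := tame_segment b c
  eventually_segment x y b hb h := by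
    simp only [segment_symm ℝ _ c] at h ⊢
    exact tame_segment x y c b hb.symm h
  eventually_tail x b hb h := by
    simp only [segment_symm ℝ _ c] at h ⊢
    exact tame_segment c x c b hb.symm h

/-- The finish whose last pieces are the rays away from the point `q`. -/
def outwardFinish (q : Plane) : Finish where
  tail y := outwardRay q y
  meet := ∅
  center := q
  dir y := y - q
  dir_ne_zero b hb := sub_ne_zero.2 hb
  meet_subset_center := empty_subset _
  meet_subset_tail b := empty_subset _
  exists_of_mem_tail b z hz := by
    obtain ⟨s, hs, rfl⟩ := hz
    exact ⟨s - 1, by linarith, by module⟩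
  add_smul_mem_tail b t h0 h1 := ⟨1 + t, by linarith, by module⟩
  mem_tail_add_smul b u ε hε z hz := by
    obtain ⟨s, hs, rfl⟩ := hz
    exact Or.inr ⟨s - 1, s * ε, by linarith, by positivity, by module⟩
  tame_tail b := tame_outwardRay q b
  eventually_segment x y b hb h := by
    -- the ray from `c` meets the segment iff `c` lies in the cone over it with apex `q`
    set G : Set Plane := (fun w : Plane × ℝ => q + w.2 • (w.1 - q)) ''
      (segment ℝ x y ×ˢ Icc (0 : ℝ) 1)
    have hG : IsClosed G :=
      (((isCompact_segment x y).prod isCompact_Icc).image (by fun_prop)).isClosed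
    have hbG : b ∈ Gᶜ := by
      rintro ⟨⟨z, t⟩, ⟨hz, h0, h1⟩, e⟩
      dsimp only at e hz h0 h1
      rcases h0.eq_or_lt with rfl | ht
      · exact hb (by rw [← e]; module)
      · refine h ⟨hz, t⁻¹, (one_le_inv₀ ht).2 h1, ?_⟩
        rw [← e, add_sub_cancel_left, smul_smul, inv_mul_cancel₀ ht.ne', one_smul, add_sub_cancel]
    filter_upwards [hG.isOpen_compl.mem_nhds hbG] with c hc
    rintro z ⟨hz, s, hs, e⟩
    refine hc ⟨⟨z, s⁻¹⟩, ⟨hz, by positivity, inv_le_one_of_one_le₀ hs⟩, ?_⟩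
    dsimp only
    rw [e, add_sub_cancel_left, smul_smul, inv_mul_cancel₀ (by positivity), one_smul,
      add_sub_cancel]
  eventually_tail x b hb h := by
    have hbC : b - q ∈ {z : Plane | ∃ t : ℝ, 0 ≤ t ∧ z = t • (x - q)}ᶜ := by
      rintro ⟨t, ht, e⟩
      have ht0 : 0 < t := lt_of_le_of_ne ht (by
        rintro rfl; exact hb (sub_eq_zero.1 (by rw [e, zero_smul])))
      have h1 : 1 ≤ max 1 t⁻¹ * t := by
        calc 1 = t⁻¹ * t := (inv_mul_cancel₀ ht0.ne').symm
          _ ≤ max 1 t⁻¹ * t := by gcongr; exact le_max_right _ _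
      exact h (a := q + (max 1 t⁻¹) • (b - q))
        ⟨⟨max 1 t⁻¹ * t, h1, by rw [e, smul_smul]⟩, ⟨_, le_max_left _ _, rfl⟩⟩
    have hc : Continuous fun y : Plane => y - q := by fun_prop
    filter_upwards [hc.continuousAt.preimage_mem_nhds
      ((isClosed_smul_nonneg (x - q)).isOpen_compl.mem_nhds hbC)] with c hc
    rintro z ⟨⟨s, hs, e⟩, ⟨s', hs', e'⟩⟩
    have hs0 : 0 < s' := by linarith
    refine hc ⟨s'⁻¹ * s, by positivity, ?_⟩
    rw [mul_smul, ← add_left_cancel (e'.symm.trans e), smul_smul, inv_mul_cancel₀ hs0.ne',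
      one_smul]

namespace Finish

variable (T : Finish)

/-- A set that stays avoided when the endpoint of a segment, or the last bend of a polyline, is
moved slightly. -/
structure Obstacle (F : Set Plane) : Prop where
  tame : Tame F
  eventually_tail : ∀ b, b ≠ T.center → F ∩ T.tail b ⊆ T.meet →
    ∀ᶠ c in 𝓝 b, F ∩ T.tail c ⊆ T.meet

variable {T}

lemma Obstacle.inward {F : Set Plane} (h : T.Obstacle F) (c : Plane) :
    (inwardFinish c).Obstacle F where
  tame := h.tame
  eventually_tail b hb hF := by
    simp only [inwardFinish, segment_symm ℝ _ c] at hF ⊢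
    exact h.tame c b hb.symm hF

lemma Obstacle.union {F G : Set Plane} (hF : T.Obstacle F) (hG : T.Obstacle G) :
    T.Obstacle (F ∪ G) where
  tame a b hab h := by
    rw [union_inter_distrib_right, union_subset_iff] at h
    filter_upwards [hF.tame a b hab h.1, hG.tame a b hab h.2] with y h1 h2
    rw [union_inter_distrib_right]
    exact union_subset h1 h2
  eventually_tail b hb h := by
    rw [union_inter_distrib_right, union_subset_iff] at h
    filter_upwards [hF.eventually_tail b hb h.1, hG.eventually_tail b hb h.2] with y h1 h2
    rw [union_inter_distrib_right]
    exact union_subset h1 h2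

lemma obstacle_biUnion {ι : Type*} [Finite ι] (p : ι → Prop) {F : ι → Set Plane}
    (h : ∀ i, p i → T.Obstacle (F i)) : T.Obstacle (⋃ (i) (_ : p i), F i) where
  tame a b hab hF := by
    simp only [iUnion_inter, iUnion_subset_iff] at hF ⊢
    rw [eventually_all]
    intro i
    by_cases hi : p i
    · filter_upwards [(h i hi).tame a b hab (hF i hi)] with y hy _ using hy
    · exact Eventually.of_forall fun y hi' => absurd hi' hi
  eventually_tail b hb hF := by
    simp only [iUnion_inter, iUnion_subset_iff] at hF ⊢
    rw [eventually_all]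
    intro i
    by_cases hi : p i
    · filter_upwards [(h i hi).eventually_tail b hb (hF i hi)] with y hy _ using hy
    · exact Eventually.of_forall fun y hi' => absurd hi' hi

lemma obstacle_segment (x y : Plane) : T.Obstacle (segment ℝ x y) :=
  ⟨tame_segment x y, T.eventually_segment x y⟩

lemma obstacle_tail (x : Plane) : T.Obstacle (T.tail x) :=
  ⟨T.tame_tail x, T.eventually_tail x⟩

/-! ### Detaching a corner -/

/-- Let a polyline run from `a` to `b` and then along `T.tail b`, and let a further segment
`[b, o]` start at `b`. The corner `b` can be moved to a nearby point, into the sector between the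
two pieces of the polyline that does not contain `[b, o]`, so that the new pieces are detached from
the old ones and from `[b, o]`, and still avoid a given obstacle. -/
lemma exists_detached_corner {a b o e : Plane} {F : Set Plane} (hab : a ≠ b) (hob : o ≠ b)
    (hbc : b ≠ T.center) (hbe : b ≠ e) (h₁ : segment ℝ a b ∩ segment ℝ b o ⊆ {b})
    (h₂ : segment ℝ a b ∩ T.tail b ⊆ {b}) (h₃ : segment ℝ b o ∩ T.tail b ⊆ {b})
    (hF : T.Obstacle F) (hFa : F ∩ segment ℝ a b ⊆ {a}) (hFb : F ∩ T.tail b ⊆ T.meet) :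
    ∃ b', b' ≠ a ∧ b' ≠ e ∧ segment ℝ a b' ∩ T.tail b' ⊆ {b'} ∧
      (F ∪ segment ℝ a b ∪ segment ℝ b o ∪ T.tail b) ∩ segment ℝ a b' ⊆ {a} ∧
      (F ∪ segment ℝ a b ∪ segment ℝ b o ∪ T.tail b) ∩ T.tail b' ⊆ T.meet := by
  have hγ := T.dir_ne_zero b hbc
  have hα : a - b ≠ 0 := sub_ne_zero.2 hab
  have hω : o - b ≠ 0 := sub_ne_zero.2 hob
  have segA : ∀ t : ℝ, 0 ≤ t → t ≤ 1 → b + t • (a - b) ∈ segment ℝ a b := fun t h0 h1 => by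
    rw [segment_symm]
    exact mem_segment_iff_exists_smul_sub.2 ⟨t, h0, h1, rfl⟩
  have segO : ∀ t : ℝ, 0 ≤ t → t ≤ 1 → b + t • (o - b) ∈ segment ℝ b o := fun t h0 h1 =>
    mem_segment_iff_exists_smul_sub.2 ⟨t, h0, h1, rfl⟩
  obtain ⟨u, hu₁, hu₂, hu₃⟩ := exists_bisecting_direction (α := a - b) (γ := T.dir b) (ω := o - b)
    hα hγ (ne_smul_of_inter_subset hα segA (T.add_smul_mem_tail b) h₂)
    (ne_smul_of_inter_subset hω segO segA (by rwa [inter_comm]))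
    (ne_smul_of_inter_subset hω segO (T.add_smul_mem_tail b) h₃) hω
  have htend : Tendsto (fun ε : ℝ => b + ε • u) (𝓝[>] 0) (𝓝 b) := by
    have hc : Continuous fun ε : ℝ => b + ε • u := by fun_prop
    have := hc.tendsto 0
    simp only [zero_smul, add_zero] at this
    exact this.mono_left nhdsWithin_le_nhds
  have ev := htend.eventually (((eventually_ne_nhds hab.symm).and (eventually_ne_nhds hbe)).and
    ((hF.tame a b hab hFa).and (hF.eventually_tail b hbc hFb)))
  obtain ⟨ε, ⟨⟨hba, hbe'⟩, hFa', hFb'⟩, hε⟩ := (ev.and self_mem_nhdsWithin).exists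
  -- points of the new and the old pieces, in terms of the directions at `b`
  have newA : ∀ z ∈ segment ℝ a (b + ε • u), z = a ∨
      ∃ l m : ℝ, 0 ≤ l ∧ 0 < m ∧ z = b + (l • (a - b) + m • u) ∧ (l = 0 → z = b + ε • u) := by
    intro z hz
    obtain ⟨t, h0, h1, rfl⟩ := mem_segment_iff_exists_smul_sub.1 hz
    rcases h0.eq_or_lt with rfl | ht
    · left; module
    · refine Or.inr ⟨1 - t, t * ε, by linarith, by positivity, by module, fun h => ?_⟩
      rw [show t = 1 by linarith]
      module
  have oldA : ∀ z ∈ segment ℝ a b, ∃ t : ℝ, 0 ≤ t ∧ z = b + t • (a - b) := by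
    intro z hz
    rw [segment_symm] at hz
    obtain ⟨t, h0, -, e⟩ := mem_segment_iff_exists_smul_sub.1 hz
    exact ⟨t, h0, e⟩
  have oldO : ∀ z ∈ segment ℝ b o, ∃ t : ℝ, 0 ≤ t ∧ z = b + t • (o - b) := by
    intro z hz
    obtain ⟨t, h0, -, e⟩ := mem_segment_iff_exists_smul_sub.1 hz
    exact ⟨t, h0, e⟩
  have ha : a ∉ T.tail b := fun h => hab (h₂ ⟨left_mem_segment ℝ a b, h⟩)
  refine ⟨b + ε • u, hba, hbe', ?_, ?_, ?_⟩
  · rintro z ⟨hz, hz'⟩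
    rcases newA z hz with rfl | ⟨l, m, hl, hm, rfl, hl0⟩
    · rcases T.mem_tail_add_smul b u ε hε _ hz' with h | ⟨l, m, hl, hm, e⟩
      · exact absurd (T.meet_subset_tail b h) ha
      · exact absurd (by linear_combination (norm := module) -e) (hu₂ l m 1 hl hm zero_le_one).1
    · rcases T.mem_tail_add_smul b u ε hε _ hz' with h | ⟨l', m', hl', hm', e⟩
      · obtain ⟨t, ht, e⟩ := T.exists_of_mem_tail b _ (T.meet_subset_tail b h)
        exact absurd (add_left_cancel e) (hu₁ l m t hl hm ht).2.1
      · exact hl0 (hu₃ l m l' m' hl hl' (add_left_cancel e))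
  · rintro z ⟨((hz | hz) | hz) | hz, hz'⟩
    · exact hFa' ⟨hz, hz'⟩
    all_goals
      rcases newA z hz' with h | ⟨l, m, hl, hm, rfl, -⟩
      · exact h
      exfalso
    · obtain ⟨t, ht, e⟩ := oldA _ hz
      exact (hu₁ l m t hl hm ht).1 (add_left_cancel e)
    · obtain ⟨t, ht, e⟩ := oldO _ hz
      exact (hu₁ l m t hl hm ht).2.2 (add_left_cancel e)
    · obtain ⟨t, ht, e⟩ := T.exists_of_mem_tail b _ hz
      exact (hu₁ l m t hl hm ht).2.1 (add_left_cancel e)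
  · rintro z ⟨((hz | hz) | hz) | hz, hz'⟩
    · exact hFb' ⟨hz, hz'⟩
    all_goals
      rcases T.mem_tail_add_smul b u ε hε z hz' with h | ⟨l, m, hl, hm, rfl⟩
      · exact h
      exfalso
    · obtain ⟨t, ht, e⟩ := oldA _ hz
      exact (hu₂ l m t hl hm ht).1 (add_left_cancel e)
    · obtain ⟨t, ht, e⟩ := oldO _ hz
      exact (hu₂ l m t hl hm ht).2.2 (add_left_cancel e)
    · obtain ⟨t, ht, e⟩ := T.exists_of_mem_tail b _ hz
      exact (hu₂ l m t hl hm ht).2.1 (add_left_cancel e)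

end Finish

namespace Finish

variable {T : Finish}

/-! ### Detaching a whole polyline -/

variable (T) in
/-- The polyline that starts at `a`, bends at the listed points, and ends with `T.tail`. -/
def path : Plane → List Plane → Set Plane
  | a, [] => T.tail a
  | a, b :: l => segment ℝ a b ∪ path b l

variable (T) in
/-- The polyline `T.path a l` does not cross or touch itself and does not bend at `T.center`. -/
def IsSimplePath : Plane → List Plane → Prop
  | a, [] => a ≠ T.center
  | a, b :: l => a ≠ T.center ∧ a ≠ b ∧ segment ℝ a b ∩ T.path b l ⊆ {b} ∧ IsSimplePath b l

lemma left_mem_tail (a : Plane) : a ∈ T.tail a := by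
  simpa using T.add_smul_mem_tail a 0 le_rfl zero_le_one

lemma left_mem_path (a : Plane) (l : List Plane) : a ∈ T.path a l := by
  cases l with
  | nil => exact left_mem_tail a
  | cons b l => exact Or.inl (left_mem_segment ℝ a b)

lemma meet_subset_path (a : Plane) (l : List Plane) : T.meet ⊆ T.path a l := by
  induction l generalizing a with
  | nil => exact T.meet_subset_tail a
  | cons b l ih => exact (ih b).trans subset_union_right

lemma IsSimplePath.ne_center {a : Plane} {l : List Plane} (h : T.IsSimplePath a l) :
    a ≠ T.center := by
  cases l with
  | nil => exact h
  | cons b l => exact h.1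

lemma obstacle_path (a : Plane) (l : List Plane) : T.Obstacle (T.path a l) := by
  induction l generalizing a with
  | nil => exact obstacle_tail a
  | cons b l ih => exact (obstacle_segment a b).union (ih b)

/-- Let `T.path b l` be a simple polyline, extended backwards by the segment `[a, b]`, and let
a further segment `[b, o]` start at `b`. Then there is a simple polyline that starts at `a` and runs
alongside `[a, b]` and `T.path b l`, on the side of `b` that avoids `[b, o]`; it has one more bend,
is detached from the old pieces, and avoids a given obstacle. Its corners are detached one after
the other, and for each of them the old corner segment takes the role of `[b, o]` next. -/
lemma exists_detached_path (l : List Plane) : ∀ (a b o : Plane) (F : Set Plane), a ≠ b → o ≠ b →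
    a ≠ T.center → T.IsSimplePath b l → segment ℝ a b ∩ segment ℝ b o ⊆ {b} →
    segment ℝ a b ∩ T.path b l ⊆ {b} → segment ℝ b o ∩ T.path b l ⊆ {b} → T.Obstacle F →
    F ∩ segment ℝ a b ⊆ {a} → F ∩ T.path b l ⊆ T.meet →
    ∃ l' : List Plane, l'.length = l.length + 1 ∧ T.IsSimplePath a l' ∧
      (F ∪ segment ℝ a b ∪ segment ℝ b o ∪ T.path b l) ∩ T.path a l' ⊆ T.meet ∪ {a} := by
  induction l with
  | nil =>
    intro a b o F hab hob hac hb h₁ h₂ h₃ hF hFa hFb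
    obtain ⟨b', hba, hbc, h, hA, hB⟩ := exists_detached_corner hab hob hb hb h₁ h₂ h₃ hF hFa hFb
    refine ⟨[b'], rfl, ⟨hac, hba.symm, h, hbc⟩, ?_⟩
    rintro z ⟨hz, hz' | hz'⟩
    · exact Or.inr (hA ⟨hz, hz'⟩)
    · exact Or.inl (hB ⟨hz, hz'⟩)
  | cons c l ih =>
    intro a b o F hab hob hac ⟨hbc₀, hbc, hbl, hc⟩ h₁ h₂ h₃ hF hFa hFb
    -- points that are not on the remaining path
    have hb : b ∉ T.path c l := fun h => hbc (hbl ⟨left_mem_segment ℝ b c, h⟩)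
    have hab' : ∀ z ∈ segment ℝ a b, z ∉ T.path c l := fun z hz h => by
      have : z = b := h₂ ⟨hz, Or.inr h⟩
      exact hb (this ▸ h)
    have hbo' : ∀ z ∈ segment ℝ b o, z ∉ T.path c l := fun z hz h => by
      have : z = b := h₃ ⟨hz, Or.inr h⟩
      exact hb (this ▸ h)
    have ha : a ∉ T.path c l := hab' a (left_mem_segment ℝ a b)
    have hcF : c ∉ F := fun h =>
      hc.ne_center (T.meet_subset_center (hFb ⟨h, Or.inl (right_mem_segment ℝ b c)⟩))
    have hcp : c ∈ T.path c l := left_mem_path c l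
    obtain ⟨b', hba, hbe, h, hA, hB⟩ := exists_detached_corner (T := inwardFinish c)
      (F := F ∪ T.path c l) hab hob hbc hbc₀ h₁ (fun z hz => h₂ ⟨hz.1, Or.inl hz.2⟩)
      (fun z hz => h₃ ⟨hz.1, Or.inl hz.2⟩) ((hF.union (obstacle_path c l)).inward c)
      (by
        rintro z ⟨hz | hz, hz'⟩
        · exact hFa ⟨hz, hz'⟩
        · exact absurd hz (hab' z hz'))
      (by
        rintro z ⟨hz | hz, hz'⟩
        · have := hFb ⟨hz, Or.inl hz'⟩
          exact hbl ⟨hz', meet_subset_path c l this⟩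
        · exact hbl ⟨hz', hz⟩)
    change (F ∪ T.path c l ∪ segment ℝ a b ∪ segment ℝ b o ∪ segment ℝ b c) ∩ segment ℝ b' c ⊆ {c}
      at hB
    change (F ∪ T.path c l ∪ segment ℝ a b ∪ segment ℝ b o ∪ segment ℝ b c) ∩ segment ℝ a b' ⊆ {a}
      at hA
    change segment ℝ a b' ∩ segment ℝ b' c ⊆ {b'} at h
    have hab'' : ∀ z ∈ segment ℝ a b', z ∉ T.path c l := fun z hz hz' => by
      have : z = a := hA ⟨Or.inl (Or.inl (Or.inl (Or.inr hz'))), hz⟩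
      exact ha (this ▸ hz')
    have hb'c : b' ≠ c := fun e => hab'' b' (right_mem_segment ℝ a b') (by rw [e]; exact hcp)
    obtain ⟨l', hl, hs, hd⟩ := ih b' c b (F ∪ segment ℝ a b' ∪ segment ℝ b o ∪ segment ℝ a b)
      hb'c hbc hbe hc
      (fun z hz => hB ⟨Or.inr (by rw [segment_symm]; exact hz.2), hz.1⟩)
      (fun z hz => hB ⟨Or.inl (Or.inl (Or.inl (Or.inr hz.2))), hz.1⟩)
      (fun z hz => hbl ⟨by rw [segment_symm]; exact hz.1, hz.2⟩)
      (((hF.union (obstacle_segment a b')).union (obstacle_segment b o)).union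
        (obstacle_segment a b))
      (by
        rintro z ⟨((hz | hz) | hz) | hz, hz'⟩
        · have : z = c := hB ⟨Or.inl (Or.inl (Or.inl (Or.inl hz))), hz'⟩
          exact absurd (this ▸ hz) hcF
        · exact h ⟨hz, hz'⟩
        · have : z = c := hB ⟨Or.inl (Or.inr hz), hz'⟩
          exact absurd (this ▸ hcp) (hbo' z hz)
        · have : z = c := hB ⟨Or.inl (Or.inl (Or.inr hz)), hz'⟩
          exact absurd (this ▸ hcp) (hab' z hz))
      (by
        rintro z ⟨((hz | hz) | hz) | hz, hz'⟩
        · exact hFb ⟨hz, Or.inr hz'⟩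
        · exact absurd hz' (hab'' z hz)
        · exact absurd hz' (hbo' z hz)
        · exact absurd hz' (hab' z hz))
    refine ⟨b' :: l', by simp [hl], ⟨hac, hba.symm, ?_, hs⟩, ?_⟩
    · rintro z ⟨hz, hz'⟩
      rcases hd ⟨Or.inl (Or.inl (Or.inl (Or.inl (Or.inl (Or.inr hz))))), hz'⟩ with h' | h'
      · exact absurd (meet_subset_path c l h') (hab'' z hz)
      · exact h'
    · rintro z ⟨hz, hz'⟩
      have seg : z ∈ segment ℝ a b' → z ∈ T.meet ∪ {a} := by
        intro hz'
        right
        rcases hz with ((hz | hz) | hz) | (hz | hz)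
        · exact hA ⟨Or.inl (Or.inl (Or.inl (Or.inl hz))), hz'⟩
        · exact hA ⟨Or.inl (Or.inl (Or.inr hz)), hz'⟩
        · exact hA ⟨Or.inl (Or.inr hz), hz'⟩
        · exact hA ⟨Or.inr hz, hz'⟩
        · exact hA ⟨Or.inl (Or.inl (Or.inl (Or.inr hz))), hz'⟩
      rcases hz' with hz' | hz'
      · exact seg hz'
      · have : z ∈ T.meet ∪ {b'} := by
          apply hd
          refine ⟨?_, hz'⟩
          rcases hz with ((hz | hz) | hz) | (hz | hz)
          · exact Or.inl (Or.inl (Or.inl (Or.inl (Or.inl (Or.inl hz)))))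
          · exact Or.inl (Or.inl (Or.inl (Or.inr hz)))
          · exact Or.inl (Or.inl (Or.inl (Or.inl (Or.inr hz))))
          · exact Or.inl (Or.inr (by rw [segment_symm]; exact hz))
          · exact Or.inr hz
        rcases this with h' | rfl
        · exact Or.inl h'
        · exact seg (right_mem_segment ℝ a z)

end Finish

/-! ### Edges and vertices of a simple polygon -/

variable {n : ℕ} {P : Polygon Plane n}

lemma edgeSet_eq_segment (P : Polygon Plane n) (i : Fin n) :
    P.edgeSet ℝ i = segment ℝ (P i) (P (finRotate n i)) :=
  affineSegment_eq_segment ℝ _ _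

lemma isCompact_boundary (P : Polygon Plane n) : IsCompact (P.boundary ℝ) :=
  isCompact_iUnion fun i => by rw [edgeSet_eq_segment]; exact isCompact_segment _ _

lemma edgeSet_subset_boundary (P : Polygon Plane n) (i : Fin n) :
    P.edgeSet ℝ i ⊆ P.boundary ℝ := subset_iUnion (P.edgeSet ℝ) i

lemma left_mem_edgeSet (P : Polygon Plane n) (i : Fin n) : P i ∈ P.edgeSet ℝ i := by
  rw [edgeSet_eq_segment]
  exact left_mem_segment ℝ _ _

lemma right_mem_edgeSet (P : Polygon Plane n) (i : Fin n) :
    P (finRotate n i) ∈ P.edgeSet ℝ i := by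
  rw [edgeSet_eq_segment]
  exact right_mem_segment ℝ _ _

lemma vertex_mem_boundary (P : Polygon Plane n) (i : Fin n) : P i ∈ P.boundary ℝ :=
  edgeSet_subset_boundary P i (left_mem_edgeSet P i)

lemma val_finRotate_pow (i : Fin n) (k : ℕ) : (((finRotate n) ^ k) i : ℕ) = (i + k) % n := by
  obtain _ | m := n
  · exact i.elim0
  induction k with
  | zero => simp [Nat.mod_eq_of_lt i.isLt]
  | succ k ih =>
    rw [pow_succ', Equiv.Perm.mul_apply, finRotate_apply, Fin.val_add, ih, ← add_assoc]
    simp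

lemma finRotate_pow_injOn (i : Fin n) :
    Set.InjOn (fun k : ℕ => ((finRotate n) ^ k) i) {k | k < n} := by
  intro k hk l hl h
  have h' := congrArg Fin.val h
  dsimp only at h'
  rw [val_finRotate_pow, val_finRotate_pow] at h'
  have : k ≡ l [MOD n] := Nat.ModEq.add_left_cancel' _ h'
  exact Nat.ModEq.eq_of_lt_of_lt this hk hl

namespace IsSimplePolygon

lemma finRotate_ne (hP : IsSimplePolygon P) (i : Fin n) : finRotate n i ≠ i := by
  intro h
  have := finRotate_pow_injOn i (x₁ := 1) (x₂ := 0) (by have := hP.three_le; simp; omega)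
    (by have := hP.three_le; simp; omega) (by simpa using h)
  omega

lemma eq_or_eq_of_mem_edgeSet (hP : IsSimplePolygon P) {s g : Fin n}
    (h : P s ∈ P.edgeSet ℝ g) :
    s = g ∨ s = finRotate n g := by
  by_contra! hne
  by_cases hg : g = finRotate n s
  · have : P s ∈ P.edgeSet ℝ s ∩ P.edgeSet ℝ (finRotate n s) :=
      ⟨left_mem_edgeSet P s, hg ▸ h⟩
    rw [hP.consecutive] at this
    exact hne.1 ((hP.injective this).trans hg.symm)
  · exact disjoint_left.1 (hP.nonconsecutive s g hne.1 hg hne.2) (left_mem_edgeSet P s) h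

end IsSimplePolygon

/-! ### Drawing the polylines one after the other -/

namespace Finish

variable {T : Finish}

variable (T P) in
/-- The polylines with the given bends start at the vertices with index in `S` and form a planar
drawing that touches the polygon only at these vertices. -/
structure IsDrawing (S : Set (Fin n)) (bends : Fin n → List Plane) : Prop where
  isSimplePath : ∀ i ∈ S, T.IsSimplePath (P i) (bends i)
  boundary_inter : ∀ i ∈ S, P.boundary ℝ ∩ T.path (P i) (bends i) ⊆ {P i}
  inter_subset : ∀ i ∈ S, ∀ j ∈ S, i ≠ j →
    T.path (P i) (bends i) ∩ T.path (P j) (bends j) ⊆ T.meet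

/-- The common part of the two cases of `IsDrawing.exists_insert`: `e` is the edge between the vertex
`i`, which has its polyline, and the new vertex `j`, and `f` is the other edge at `i`. -/
lemma IsDrawing.exists_insert_aux {S : Set (Fin n)} {bends : Fin n → List Plane}
    (hD : T.IsDrawing P S bends) (hinj : Function.Injective P.vertices)
    (hcen : ∀ i, P i ≠ T.center) (hmeet : Disjoint (P.boundary ℝ) T.meet)
    {i j k e f : Fin n} (hi : i ∈ S) (hj : j ∉ S) (hji : j ≠ i) (hki : k ≠ i)
    (he : P.edgeSet ℝ e = segment ℝ (P j) (P i)) (hf : P.edgeSet ℝ f = segment ℝ (P i) (P k))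
    (hef : P.edgeSet ℝ e ∩ P.edgeSet ℝ f ⊆ {P i})
    (hgi : ∀ g, g ≠ e → g ≠ f → P i ∉ P.edgeSet ℝ g)
    (hge : ∀ g, g ≠ e → g ≠ f → P.edgeSet ℝ g ∩ P.edgeSet ℝ e ⊆ {P j})
    (hs : ∀ s, P s ∈ P.edgeSet ℝ e → s = i ∨ s = j) :
    ∃ l : List Plane, l.length = (bends i).length + 1 ∧
      T.IsDrawing P (insert j S) (Function.update bends j l) := by
  have hbd := hD.boundary_inter i hi
  have hPji : P j ≠ P i := fun h => hji (hinj h)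
  obtain ⟨l, hl, hsim, hdis⟩ := exists_detached_path (T := T) (bends i) (P j) (P i) (P k)
    ((⋃ (g) (_ : g ≠ e ∧ g ≠ f), P.edgeSet ℝ g) ∪
      ⋃ (s) (_ : s ∈ S ∧ s ≠ i), T.path (P s) (bends s))
    hPji (fun h => hki (hinj h)) (hcen j) (hD.isSimplePath i hi)
    (by rwa [← he, ← hf])
    (by
      rw [← he]
      exact fun z hz => hbd ⟨edgeSet_subset_boundary P e hz.1, hz.2⟩)
    (by
      rw [← hf]
      exact fun z hz => hbd ⟨edgeSet_subset_boundary P f hz.1, hz.2⟩)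
    ((obstacle_biUnion _ fun g _ => by rw [edgeSet_eq_segment]; exact obstacle_segment _ _).union
      (obstacle_biUnion _ fun s _ => obstacle_path _ _))
    (by
      rw [← he]
      rintro z ⟨hz | hz, hz'⟩
      · simp only [mem_iUnion, exists_prop] at hz
        obtain ⟨g, ⟨h1, h2⟩, hz⟩ := hz
        exact hge g h1 h2 ⟨hz, hz'⟩
      · simp only [mem_iUnion, exists_prop] at hz
        obtain ⟨s, ⟨h1, h2⟩, hz⟩ := hz
        have : z = P s := hD.boundary_inter s h1 ⟨edgeSet_subset_boundary P e hz', hz⟩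
        subst this
        rcases hs s hz' with rfl | rfl
        · exact absurd rfl h2
        · exact absurd h1 hj)
    (by
      rintro z ⟨hz | hz, hz'⟩
      · simp only [mem_iUnion, exists_prop] at hz
        obtain ⟨g, ⟨h1, h2⟩, hz⟩ := hz
        have : z = P i := hbd ⟨edgeSet_subset_boundary P g hz, hz'⟩
        exact absurd (this ▸ hz) (hgi g h1 h2)
      · simp only [mem_iUnion, exists_prop] at hz
        obtain ⟨s, ⟨h1, h2⟩, hz⟩ := hz
        exact hD.inter_subset s h1 i hi h2 ⟨hz, hz'⟩)
  have hnew : P.boundary ℝ ∩ T.path (P j) l ⊆ {P j} := by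
    rintro z ⟨hz, hz'⟩
    have hz0 := hz
    obtain ⟨g, hz⟩ := mem_iUnion.1 hz
    have : z ∈ T.meet ∪ {P j} := by
      apply hdis
      refine ⟨?_, hz'⟩
      by_cases h1 : g = e
      · exact Or.inl (Or.inl (Or.inr (by rw [← he, ← h1]; exact hz)))
      by_cases h2 : g = f
      · exact Or.inl (Or.inr (by rw [← hf, ← h2]; exact hz))
      · exact Or.inl (Or.inl (Or.inl (Or.inl (mem_biUnion (s := {g | g ≠ e ∧ g ≠ f})
          ⟨h1, h2⟩ hz))))
    rcases this with h | h
    · exact absurd h (disjoint_left.1 hmeet hz0)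
    · exact h
  have hpair : ∀ s ∈ S, T.path (P s) (bends s) ∩ T.path (P j) l ⊆ T.meet := by
    rintro s hsS z ⟨hz, hz'⟩
    have : z ∈ T.meet ∪ {P j} := by
      apply hdis
      refine ⟨?_, hz'⟩
      by_cases h1 : s = i
      · exact Or.inr (h1 ▸ hz)
      · exact Or.inl (Or.inl (Or.inl (Or.inr (mem_biUnion (s := {s | s ∈ S ∧ s ≠ i})
          ⟨hsS, h1⟩ hz))))
    rcases this with h | h
    · exact h
    · rw [mem_singleton_iff] at h
      subst h
      have : P j = P s := hD.boundary_inter s hsS ⟨vertex_mem_boundary P j, hz⟩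
      exact absurd (hinj this ▸ hsS) hj
  refine ⟨l, hl, ?_, ?_, ?_⟩
  · rintro s (rfl | hsS)
    · simpa using hsim
    · rw [Function.update_of_ne (by rintro rfl; exact hj hsS)]
      exact hD.isSimplePath s hsS
  · rintro s (rfl | hsS)
    · simpa using hnew
    · rw [Function.update_of_ne (by rintro rfl; exact hj hsS)]
      exact hD.boundary_inter s hsS
  · rintro s (rfl | hsS) t (rfl | htS) hst
    · exact absurd rfl hst
    · rw [Function.update_self, Function.update_of_ne hst.symm, inter_comm]
      exact hpair t htS
    · rw [Function.update_self, Function.update_of_ne hst]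
      exact hpair s hsS
    · rw [Function.update_of_ne (by rintro rfl; exact hj hsS),
        Function.update_of_ne (by rintro rfl; exact hj htS)]
      exact hD.inter_subset s hsS t htS hst

/-- A drawing can be extended to a neighbour of a vertex that has its polyline already, at the
price of one more bend: the new polyline follows the common edge and then the old polyline. -/
lemma IsDrawing.exists_insert {S : Set (Fin n)} {bends : Fin n → List Plane}
    (hD : T.IsDrawing P S bends) (hP : IsSimplePolygon P)
    (hcen : ∀ i, P i ≠ T.center) (hmeet : Disjoint (P.boundary ℝ) T.meet)
    {i j : Fin n} (hi : i ∈ S) (hj : j ∉ S) (hij : finRotate n j = i ∨ finRotate n i = j) :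
    ∃ l : List Plane, l.length = (bends i).length + 1 ∧
      T.IsDrawing P (insert j S) (Function.update bends j l) := by
  rcases hij with rfl | rfl
  · refine hD.exists_insert_aux hP.injective hcen hmeet (i := finRotate n j) (j := j)
      (k := finRotate n (finRotate n j)) (e := j) (f := finRotate n j) hi hj
      (hP.finRotate_ne j).symm (hP.finRotate_ne _) (edgeSet_eq_segment P _)
      (edgeSet_eq_segment P _) (hP.consecutive j).subset ?_ ?_ ?_
    · intro g h1 h2 h
      rcases hP.eq_or_eq_of_mem_edgeSet h with h | h
      · exact h2 h.symm
      · exact h1 ((finRotate n).injective h).symm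
    · intro g h1 h2
      by_cases h3 : j = finRotate n g
      · have := hP.consecutive g
        rw [← h3] at this
        exact this.subset
      · rw [(hP.nonconsecutive g j h1 h3 h2).inter_eq]
        exact empty_subset _
    · exact fun s h => (hP.eq_or_eq_of_mem_edgeSet h).symm
  · obtain ⟨k, rfl⟩ := (finRotate n).surjective i
    refine hD.exists_insert_aux hP.injective hcen hmeet (i := finRotate n k)
      (j := finRotate n (finRotate n k)) (k := k) (e := finRotate n k) (f := k) hi hj
      (hP.finRotate_ne _) (hP.finRotate_ne k).symm ?_ ?_ ?_ ?_ ?_ ?_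
    · rw [segment_symm]
      exact edgeSet_eq_segment P _
    · rw [segment_symm]
      exact edgeSet_eq_segment P _
    · rw [inter_comm]
      exact (hP.consecutive k).subset
    · intro g h1 h2 h
      rcases hP.eq_or_eq_of_mem_edgeSet h with h | h
      · exact h1 h.symm
      · exact h2 ((finRotate n).injective h).symm
    · intro g h1 h2
      by_cases h3 : g = finRotate n (finRotate n k)
      · rw [h3, inter_comm]
        exact (hP.consecutive _).subset
      · rw [(hP.nonconsecutive g (finRotate n k) h1
          (fun h => h2 ((finRotate n).injective h).symm) h3).inter_eq]
        exact empty_subset _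
    · exact fun s h => hP.eq_or_eq_of_mem_edgeSet h

/-- The indices at cyclic distance at most `d` from `S`. -/
def cyclicNhd (S : Set (Fin n)) : ℕ → Set (Fin n)
  | 0 => S
  | d + 1 => {i | i ∈ cyclicNhd S d ∨ finRotate n i ∈ cyclicNhd S d ∨
      (finRotate n).symm i ∈ cyclicNhd S d}

lemma cyclicNhd_mono (S : Set (Fin n)) : Monotone (cyclicNhd S) :=
  monotone_nat_of_le_succ fun _ _ hi => Or.inl hi

lemma mem_cyclicNhd_of_pow (S : Set (Fin n)) (k : ℕ) :
    ∀ i : Fin n, ((finRotate n) ^ k) i ∈ S → i ∈ cyclicNhd S k := by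
  induction k with
  | zero => exact fun i h => h
  | succ k ih =>
    intro i h
    exact Or.inr (Or.inl (ih _ (by rwa [pow_succ, Equiv.Perm.mul_apply] at h)))

lemma pow_mem_cyclicNhd (S : Set (Fin n)) (k : ℕ) :
    ∀ i ∈ S, ((finRotate n) ^ k) i ∈ cyclicNhd S k := by
  induction k with
  | zero => exact fun i h => h
  | succ k ih =>
    intro i h
    refine Or.inr (Or.inr ?_)
    rw [pow_succ', Equiv.Perm.mul_apply, Equiv.symm_apply_apply]
    exact ih i h

/-- Among `n` points on a cycle, every point is at distance at most `(n - 2) / 2` from three given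
ones. -/
lemma mem_cyclicNhd_of_three_le_card (S : Finset (Fin n)) (hS : 3 ≤ S.card) (i : Fin n) :
    i ∈ cyclicNhd (S : Set (Fin n)) ((n - 2) / 2) := by
  by_contra hi
  set β := (n - 2) / 2 with hβ
  have hn : 3 ≤ n := hS.trans (by simpa using S.card_le_univ)
  obtain ⟨j, rfl⟩ := ((finRotate n) ^ β).surjective i
  -- all points of the arc of length `2 * β` around the given point would lie outside `S`
  have hdisj : Disjoint S ((Finset.range (2 * β + 1)).image fun k => ((finRotate n) ^ k) j) := by
    rw [Finset.disjoint_right]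
    intro m hm hmS
    obtain ⟨k, hk, rfl⟩ := Finset.mem_image.1 hm
    rw [Finset.mem_range] at hk
    apply hi
    rcases le_total k β with h | h
    · have := pow_mem_cyclicNhd (S : Set (Fin n)) (β - k) _ (Finset.mem_coe.2 hmS)
      rw [← Equiv.Perm.mul_apply, ← pow_add, Nat.sub_add_cancel h] at this
      exact cyclicNhd_mono _ (Nat.sub_le _ _) this
    · refine cyclicNhd_mono _ (show k - β ≤ β by omega) (mem_cyclicNhd_of_pow _ (k - β) _ ?_)
      rw [← Equiv.Perm.mul_apply, ← pow_add, Nat.sub_add_cancel h]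
      exact hmS
  have hcard := (Finset.card_union_of_disjoint hdisj).symm.trans_le (Finset.card_le_univ _)
  rw [Finset.card_image_of_injOn, Finset.card_range, Fintype.card_fin] at hcard
  · omega
  · exact (finRotate_pow_injOn j).mono fun k hk => by
      have : k < 2 * β + 1 := by simpa using hk
      change k < n
      omega

/-- Three vertices whose last pieces form a planar drawing suffice: the drawing extends to all
vertices, along the polygon, and a vertex at cyclic distance `d` from the three gets `d` bends. -/
theorem exists_isDrawing_univ (hP : IsSimplePolygon P) (hcen : ∀ i, P i ≠ T.center)
    (hmeet : Disjoint (P.boundary ℝ) T.meet) (S : Finset (Fin n)) (hS : 3 ≤ S.card)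
    (hbd : ∀ i ∈ S, P.boundary ℝ ∩ T.tail (P i) ⊆ {P i})
    (hpair : ∀ i ∈ S, ∀ j ∈ S, i ≠ j → T.tail (P i) ∩ T.tail (P j) ⊆ T.meet) :
    ∃ bends : Fin n → List Plane, T.IsDrawing P univ bends ∧
      ∀ i, (bends i).length ≤ (n - 2) / 2 := by
  have key : ∀ d : ℕ, ∃ bends : Fin n → List Plane,
      T.IsDrawing P (cyclicNhd (S : Set (Fin n)) d) bends ∧
        ∀ i ∈ cyclicNhd (S : Set (Fin n)) d, (bends i).length ≤ d := by
    intro d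
    induction d with
    | zero =>
      exact ⟨fun _ => [], ⟨fun i _ => hcen i, hbd, hpair⟩, fun i _ => le_rfl⟩
    | succ d ih =>
      obtain ⟨bends₀, hD₀, hl₀⟩ := ih
      set N := cyclicNhd (S : Set (Fin n)) d
      have step : ∀ R : Finset (Fin n), (∀ j ∈ R, j ∈ cyclicNhd (S : Set (Fin n)) (d + 1)) →
          ∃ bends : Fin n → List Plane, T.IsDrawing P (N ∪ R) bends ∧
            (∀ i ∈ N, (bends i).length ≤ d) ∧ ∀ i ∈ N ∪ R, (bends i).length ≤ d + 1 := by
        intro R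
        induction R using Finset.induction_on with
        | empty =>
          intro _
          exact ⟨bends₀, by simpa using hD₀, hl₀, fun i hi =>
            (hl₀ i (by simpa using hi)).trans (Nat.le_succ d)⟩
        | insert j R hjR ih =>
          intro hR
          obtain ⟨bends, hD, hlN, hl⟩ := ih fun j hj => hR j (Finset.mem_insert_of_mem hj)
          have hset : N ∪ ((insert j R : Finset (Fin n)) : Set (Fin n)) = insert j (N ∪ R) := by
            rw [Finset.coe_insert, union_insert]
          rw [hset]
          by_cases hj : j ∈ N ∪ R
          · rw [insert_eq_of_mem hj]
            exact ⟨bends, hD, hlN, hl⟩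
          have hjN : j ∉ N := fun h => hj (Or.inl h)
          have hadj : ∃ i ∈ N, finRotate n j = i ∨ finRotate n i = j := by
            rcases hR j (Finset.mem_insert_self j R) with h | h | h
            · exact absurd h hjN
            · exact ⟨_, h, Or.inl rfl⟩
            · exact ⟨_, h, Or.inr (Equiv.apply_symm_apply _ _)⟩
          obtain ⟨i, hi, hij⟩ := hadj
          obtain ⟨l, hlen, hD'⟩ := hD.exists_insert hP hcen hmeet (Or.inl hi) hj hij
          refine ⟨_, hD', fun s hs => ?_, fun s hs => ?_⟩
          · rw [Function.update_of_ne (by rintro rfl; exact hjN hs)]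
            exact hlN s hs
          · by_cases hsj : s = j
            · subst hsj
              rw [Function.update_self, hlen]
              exact Nat.succ_le_succ (hlN i hi)
            · rw [Function.update_of_ne hsj]
              exact hl s (hs.resolve_left hsj)
      obtain ⟨bends, hD, -, hl⟩ := step (Set.toFinite (cyclicNhd (S : Set (Fin n)) (d + 1))).toFinset
        fun j hj => by simpa using hj
      have hset : N ∪ ((Set.toFinite (cyclicNhd (S : Set (Fin n)) (d + 1))).toFinset :
          Set (Fin n)) = cyclicNhd (S : Set (Fin n)) (d + 1) := by
        rw [Set.Finite.coe_toFinset]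
        exact union_eq_right.2 fun i hi => Or.inl hi
      rw [hset] at hD hl
      exact ⟨bends, hD, hl⟩
  obtain ⟨bends, hD, hl⟩ := key ((n - 2) / 2)
  have huniv : cyclicNhd (S : Set (Fin n)) ((n - 2) / 2) = univ :=
    eq_univ_of_forall (mem_cyclicNhd_of_three_le_card S hS)
  rw [huniv] at hD hl
  exact ⟨bends, hD, fun i => hl i (mem_univ i)⟩

end Finish

/-! ### The winding number and points inside -/

/-- The plane as the complex plane. -/
noncomputable def toComplex : Plane ≃ₗᵢ[ℝ] ℂ := Complex.orthonormalBasisOneI.repr.symm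

lemma eq_of_toComplex_sub_eq_zero {a b : Plane} (h : toComplex (a - b) = 0) : a = b :=
  sub_eq_zero.1 (toComplex.injective (by rw [h, map_zero]))

/-- The oriented angle under which the segment from `a` to `b` is seen from `x`. -/
noncomputable def viewAngle (a b x : Plane) : ℝ :=
  Complex.arg (toComplex (b - x) / toComplex (a - x))

lemma mem_slitPlane_of_notMem_segment {a b x : Plane} (hx : x ∉ segment ℝ a b) :
    toComplex (b - x) / toComplex (a - x) ∈ Complex.slitPlane := by
  by_contra h
  rw [Complex.mem_slitPlane_iff, not_or, not_lt, not_not] at h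
  set r := (toComplex (b - x) / toComplex (a - x)).re with hr
  have hne' : toComplex (a - x) ≠ 0 := fun h0 => hx (by
    rw [← eq_of_toComplex_sub_eq_zero h0]; exact left_mem_segment ℝ a b)
  have hq : toComplex (b - x) / toComplex (a - x) = (r : ℂ) :=
    Complex.ext (by simp [hr]) (by simpa using h.2)
  have he : b - x = r • (a - x) := by
    apply toComplex.injective
    rw [map_smul, Complex.real_smul, ← hq, div_mul_cancel₀ _ hne']
  have hr1 : 0 < 1 - r := by linarith [h.1]
  refine hx (mem_segment_iff_exists_smul_sub.2 ⟨(1 - r)⁻¹, by positivity,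
    inv_le_one_of_one_le₀ (by linarith [h.1]), ?_⟩)
  have h2 : (1 - r) • (x - a) = b - a := by linear_combination (norm := module) -he
  rw [← h2, smul_smul, inv_mul_cancel₀ hr1.ne', one_smul, add_sub_cancel]

lemma continuousAt_viewAngle {a b x : Plane} (hx : x ∉ segment ℝ a b) :
    ContinuousAt (viewAngle a b) x := by
  have hne : toComplex (a - x) ≠ 0 := fun h0 => hx (by
    rw [← eq_of_toComplex_sub_eq_zero h0]; exact left_mem_segment ℝ a b)
  have hc : ∀ c : Plane, ContinuousAt (fun y => toComplex (c - y)) x := fun c =>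
    (toComplex.continuous.comp (continuous_const.sub continuous_id)).continuousAt
  have h1 : ContinuousAt (fun y => toComplex (b - y) / toComplex (a - y)) x :=
    (hc b).div (hc a) hne
  exact ContinuousAt.comp (f := fun y => toComplex (b - y) / toComplex (a - y))
    (Complex.continuousAt_arg (mem_slitPlane_of_notMem_segment hx)) h1

lemma tendsto_viewAngle_cobounded (a b : Plane) :
    Tendsto (viewAngle a b) (Bornology.cobounded Plane) (𝓝 0) := by
  have h1 : Tendsto (fun x : Plane => ‖toComplex (a - x)‖) (Bornology.cobounded Plane) atTop := by
    simp only [LinearIsometryEquiv.norm_map]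
    have : Tendsto (fun x : Plane => ‖x‖ - ‖a‖) (Bornology.cobounded Plane) atTop :=
      tendsto_atTop_add_const_right _ _ tendsto_norm_cobounded_atTop
    refine tendsto_atTop_mono (fun x => ?_) this
    rw [norm_sub_rev]
    exact norm_sub_norm_le x a
  have h2 : Tendsto (fun x : Plane => toComplex (b - a) / toComplex (a - x))
      (Bornology.cobounded Plane) (𝓝 0) := by
    rw [tendsto_zero_iff_norm_tendsto_zero]
    simp only [norm_div]
    exact h1.const_div_atTop _
  have h3 : Tendsto (fun x : Plane => toComplex (b - x) / toComplex (a - x))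
      (Bornology.cobounded Plane) (𝓝 1) := by
    have h4 := h2.const_add 1
    rw [add_zero] at h4
    refine h4.congr' ?_
    filter_upwards [h1.eventually_gt_atTop 0] with x hx
    have hne : toComplex (a - x) ≠ 0 := norm_pos_iff.1 hx
    field_simp
    rw [← map_add]
    congr 1
    module
  have := (Complex.continuousAt_arg Complex.one_mem_slitPlane).tendsto.comp h3
  rwa [Complex.arg_one] at this

/-- The winding number of the polygon around `x`, multiplied by `2 * π`. -/
noncomputable def winding (P : Polygon Plane n) (x : Plane) : ℝ :=
  ∑ i, viewAngle (P i) (P (finRotate n i)) x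

lemma notMem_segment_of_notMem_boundary {x : Plane} (hx : x ∉ P.boundary ℝ) (i : Fin n) :
    x ∉ segment ℝ (P i) (P (finRotate n i)) := fun h => by
  rw [← edgeSet_eq_segment] at h
  exact hx (edgeSet_subset_boundary P i h)

lemma exists_winding_eq {x : Plane} (hx : x ∉ P.boundary ℝ) :
    ∃ k : ℤ, winding P x = 2 * Real.pi * k := by
  have hne : ∀ i, toComplex (P i - x) ≠ 0 := fun i h => hx (by
    rw [← eq_of_toComplex_sub_eq_zero h]
    exact vertex_mem_boundary P i)
  have h : ((winding P x : ℝ) : Real.Angle) = ((0 : ℝ) : Real.Angle) := by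
    have h1 : ∀ i, ((viewAngle (P i) (P (finRotate n i)) x : ℝ) : Real.Angle) =
        (Complex.arg (toComplex (P (finRotate n i) - x)) : Real.Angle) -
          (Complex.arg (toComplex (P i - x)) : Real.Angle) :=
      fun i => Complex.arg_div_coe_angle (hne _) (hne _)
    have h2 : ((winding P x : ℝ) : Real.Angle) =
        ∑ i, ((viewAngle (P i) (P (finRotate n i)) x : ℝ) : Real.Angle) :=
      map_sum Real.Angle.coeHom _ _
    rw [h2]
    simp only [h1]
    rw [Finset.sum_sub_distrib,
      Equiv.sum_comp (finRotate n) fun i => (Complex.arg (toComplex (P i - x)) : Real.Angle),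
      sub_self, Real.Angle.coe_zero]
  rw [Real.Angle.angle_eq_iff_two_pi_dvd_sub] at h
  simpa using h

/-- The winding number vanishes outside the polygon. -/
lemma winding_eq_zero {x : Plane} (hx : x ∈ outside P) : winding P x = 0 := by
  obtain ⟨hxP, hub⟩ := hx
  set C := connectedComponentIn (P.boundary ℝ)ᶜ x
  have hCsub : C ⊆ (P.boundary ℝ)ᶜ := connectedComponentIn_subset _ _
  have hpi := Real.pi_pos
  have hzero : ∀ y ∈ C, |winding P y| < 2 * Real.pi → winding P y = 0 := by
    intro y hy hlt
    obtain ⟨k, hk⟩ := exists_winding_eq (hCsub hy)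
    have : |(k : ℝ)| < 1 := by
      rw [hk, abs_mul, abs_of_pos (by positivity)] at hlt
      nlinarith
    have hk0 : k = 0 := by
      rw [← Int.abs_lt_one_iff]
      exact_mod_cast this
    rw [hk, hk0]
    simp
  have htend : Tendsto (winding P) (Bornology.cobounded Plane) (𝓝 0) := by
    have := tendsto_finsetSum (Finset.univ : Finset (Fin n))
      fun i _ => tendsto_viewAngle_cobounded (P i) (P (finRotate n i))
    rwa [Finset.sum_const_zero] at this
  have hev : ∀ᶠ y in Bornology.cobounded Plane, |winding P y| < 2 * Real.pi := by
    have := htend.abs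
    rw [abs_zero] at this
    exact this.eventually (gt_mem_nhds (by positivity))
  obtain ⟨y, hyC, hy⟩ : ∃ y ∈ C, |winding P y| < 2 * Real.pi := by
    by_contra! hcon
    apply hub
    rw [Bornology.isBounded_def]
    filter_upwards [hev] with y hy hyC
    exact (hcon y hyC).not_gt hy
  have hy0 := hzero y hyC hy
  have hcont : ContinuousOn (winding P) C := fun z hz =>
    (tendsto_finsetSum _ fun i _ => (continuousAt_viewAngle
      (notMem_segment_of_notMem_boundary (hCsub hz) i)).tendsto).mono_left nhdsWithin_le_nhds
  have hxC : x ∈ C := mem_connectedComponentIn hxP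
  by_contra hne
  -- otherwise the winding number would take the values `1 / 2` or `-1 / 2` in between
  have hpre : IsPreconnected C := isPreconnected_connectedComponentIn
  have hbig : 2 * Real.pi ≤ |winding P x| := by
    by_contra h
    exact hne (hzero x hxC (not_le.1 h))
  have hval : ∀ z ∈ C, |winding P z| = Real.pi → False := by
    intro z hz h
    have := hzero z hz (by rw [h]; linarith)
    rw [this, abs_zero] at h
    linarith
  rcases le_total 0 (winding P x) with h | h
  · rw [abs_of_nonneg h] at hbig
    obtain ⟨z, hz, e⟩ := hpre.intermediate_value hyC hxC hcont
      (show Real.pi ∈ Icc _ _ by rw [hy0]; exact ⟨hpi.le, by linarith⟩)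
    exact hval z hz (by rw [e, abs_of_pos hpi])
  · rw [abs_of_nonpos h] at hbig
    obtain ⟨z, hz, e⟩ := hpre.intermediate_value hxC hyC hcont
      (show -Real.pi ∈ Icc _ _ by rw [hy0]; exact ⟨by linarith, by linarith⟩)
    exact hval z hz (by rw [e, abs_neg, abs_of_pos hpi])

/-- The view angle of a segment jumps by `2 * π` when its midpoint is crossed. -/
lemma tendsto_viewAngle_midpoint {a b : Plane} (hab : a ≠ b) :
    ∃ v : Plane, (∀ t : ℝ, t ≠ 0 → midpoint ℝ a b + t • v ∉ segment ℝ a b) ∧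
      Tendsto (fun t : ℝ => viewAngle a b (midpoint ℝ a b + t • v)) (𝓝[>] 0) (𝓝 Real.pi) ∧
      Tendsto (fun t : ℝ => viewAngle a b (midpoint ℝ a b + t • v)) (𝓝[<] 0) (𝓝 (-Real.pi)) := by
  set d := toComplex (b - a) with hd
  have hd0 : d ≠ 0 := fun h => hab (eq_of_toComplex_sub_eq_zero h).symm
  set v := toComplex.symm (Complex.I * d) with hv
  have hvI : toComplex v = Complex.I * d := by simp [hv]
  have hm : midpoint ℝ a b = a + (1 / 2 : ℝ) • (b - a) := by
    rw [midpoint_eq_smul_add]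
    simp only [invOf_eq_inv]
    module
  set r : ℝ → ℂ := fun t => (1 / 2 - t * Complex.I) / (-1 / 2 - t * Complex.I) with hr
  have hden : ∀ t : ℝ, (-1 / 2 - t * Complex.I : ℂ) ≠ 0 := fun t h => by
    have := congrArg Complex.re h
    norm_num at this
  have hview : ∀ t : ℝ, viewAngle a b (midpoint ℝ a b + t • v) = Complex.arg (r t) := by
    intro t
    have h1 : toComplex (b - (midpoint ℝ a b + t • v)) = (1 / 2 - t * Complex.I) * d := by
      rw [hm, show b - (a + (1 / 2 : ℝ) • (b - a) + t • v) = (1 / 2 : ℝ) • (b - a) - t • v by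
        module, map_sub, map_smul, map_smul, hvI, Complex.real_smul, Complex.real_smul, ← hd]
      push_cast
      ring
    have h2 : toComplex (a - (midpoint ℝ a b + t • v)) = (-1 / 2 - t * Complex.I) * d := by
      rw [hm, show a - (a + (1 / 2 : ℝ) • (b - a) + t • v) = (-1 / 2 : ℝ) • (b - a) - t • v by
        module, map_sub, map_smul, map_smul, hvI, Complex.real_smul, Complex.real_smul, ← hd]
      push_cast
      ring
    rw [viewAngle, h1, h2, mul_div_mul_right _ _ hd0]
  have him : ∀ t : ℝ, (r t).im = t / (1 / 4 + t ^ 2) := by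
    intro t
    have : (1 / 4 + t ^ 2 : ℝ) ≠ 0 := by positivity
    have hns : Complex.normSq (-1 / 2 - t * Complex.I) = 1 / 4 + t ^ 2 := by
      rw [Complex.normSq_apply]
      simp
      ring
    simp only [hr, Complex.div_im, hns]
    simp
    field_simp
    ring
  have hr0 : r 0 = -1 := by simp only [hr]; norm_num
  have hrc : Tendsto r (𝓝 0) (𝓝 (-1)) := by
    have hc : ∀ c : ℂ, ContinuousAt (fun t : ℝ => c - t * Complex.I) 0 := fun c => by fun_prop
    have : ContinuousAt r 0 := (hc (1 / 2)).div (hc (-1 / 2)) (hden 0)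
    simpa [hr0] using this.tendsto
  refine ⟨v, ?_, ?_, ?_⟩
  · intro t ht h
    obtain ⟨s, -, -, e⟩ := mem_segment_iff_exists_smul_sub.1 h
    have e2 : t • v = (s - 1 / 2) • (b - a) := by
      rw [hm] at e
      linear_combination (norm := module) e
    have e3 := congrArg toComplex e2
    rw [map_smul, map_smul, hvI, Complex.real_smul, Complex.real_smul, ← hd, ← mul_assoc] at e3
    have e4 := congrArg Complex.im (mul_right_cancel₀ hd0 e3)
    simp at e4
    exact ht e4
  · simp only [hview]
    have h1 : Tendsto r (𝓝[>] 0) (𝓝[{z : ℂ | 0 ≤ z.im}] (-1)) := by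
      apply tendsto_nhdsWithin_of_tendsto_nhds_of_eventually_within _
        (hrc.mono_left nhdsWithin_le_nhds)
      filter_upwards [self_mem_nhdsWithin] with t ht
      have ht' : (0 : ℝ) < t := ht
      change 0 ≤ (r t).im
      rw [him]
      positivity
    have h2 := (Complex.continuousWithinAt_arg_of_re_neg_of_im_zero (z := -1) (by simp)
      (by simp)).tendsto.comp h1
    simpa [Function.comp_def] using h2
  · simp only [hview]
    have h1 : Tendsto r (𝓝[<] 0) (𝓝[{z : ℂ | z.im < 0}] (-1)) := by
      apply tendsto_nhdsWithin_of_tendsto_nhds_of_eventually_within _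
        (hrc.mono_left nhdsWithin_le_nhds)
      filter_upwards [self_mem_nhdsWithin] with t ht
      have ht' : t < (0 : ℝ) := ht
      change (r t).im < 0
      rw [him]
      exact div_neg_of_neg_of_pos ht' (by positivity)
    exact (Complex.tendsto_arg_nhdsWithin_im_neg_of_re_neg_of_im_zero (z := -1) (by simp)
      (by simp)).comp h1

/-- A simple polygon has an inside: the winding number cannot vanish on both sides of an edge. -/
theorem inside_nonempty (hP : IsSimplePolygon P) : (inside P).Nonempty := by
  by_contra hempty
  have hout : ∀ x, x ∉ P.boundary ℝ → winding P x = 0 := fun x hx =>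
    winding_eq_zero ⟨hx, fun hb => hempty ⟨x, hx, hb⟩⟩
  set i : Fin n := ⟨0, by have := hP.three_le; omega⟩
  have hab : P i ≠ P (finRotate n i) := fun h => hP.finRotate_ne i (hP.injective h).symm
  obtain ⟨v, hv, hpos, hneg⟩ := tendsto_viewAngle_midpoint hab
  set m := midpoint ℝ (P i) (P (finRotate n i))
  have hmi : m ∈ P.edgeSet ℝ i := by
    rw [edgeSet_eq_segment]
    exact midpoint_mem_segment _ _
  have hmv : ∀ s, m ≠ P s := by
    intro s h
    rcases hP.eq_or_eq_of_mem_edgeSet (h ▸ hmi) with rfl | rfl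
    · exact hab ((midpoint_eq_left_iff _).1 h)
    · exact hab ((midpoint_eq_right_iff _).1 h)
  have hmj : ∀ j, j ≠ i → m ∉ segment ℝ (P j) (P (finRotate n j)) := by
    intro j hj h
    rw [← edgeSet_eq_segment] at h
    by_cases h1 : j = finRotate n i
    · have : m ∈ P.edgeSet ℝ i ∩ P.edgeSet ℝ (finRotate n i) := ⟨hmi, h1 ▸ h⟩
      rw [hP.consecutive] at this
      exact hmv _ this
    by_cases h2 : i = finRotate n j
    · have : m ∈ P.edgeSet ℝ j ∩ P.edgeSet ℝ (finRotate n j) := ⟨h, h2 ▸ hmi⟩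
      rw [hP.consecutive] at this
      exact hmv _ this
    · exact disjoint_left.1 (hP.nonconsecutive i j hj.symm h1 h2) hmi h
  have hline : Tendsto (fun t : ℝ => m + t • v) (𝓝 0) (𝓝 m) := by
    have hc : Continuous fun t : ℝ => m + t • v := by fun_prop
    simpa using hc.tendsto 0
  set rest : Plane → ℝ := fun x =>
    ∑ j ∈ Finset.univ.erase i, viewAngle (P j) (P (finRotate n j)) x
  have hrestc : Tendsto (fun t : ℝ => rest (m + t • v)) (𝓝 0) (𝓝 (rest m)) :=
    (tendsto_finsetSum _ fun j hj =>
      (continuousAt_viewAngle (hmj j (Finset.ne_of_mem_erase hj))).tendsto).comp hline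
  have hsplit : ∀ x, winding P x = viewAngle (P i) (P (finRotate n i)) x + rest x := fun x =>
    (Finset.add_sum_erase _ _ (Finset.mem_univ i)).symm
  have hoff : ∀ᶠ t : ℝ in 𝓝 0, t ≠ 0 → m + t • v ∉ P.boundary ℝ := by
    have : ∀ᶠ t : ℝ in 𝓝 0, ∀ j, j ≠ i → m + t • v ∉ segment ℝ (P j) (P (finRotate n j)) := by
      rw [eventually_all]
      intro j
      by_cases hj : j = i
      · exact Eventually.of_forall fun t h => absurd hj h
      · filter_upwards [hline.eventually ((isClosed_segment (P j)
          (P (finRotate n j))).isOpen_compl.mem_nhds (hmj j hj))] with t ht _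
        exact ht
    filter_upwards [this] with t ht ht0 hbd
    obtain ⟨j, hj⟩ := mem_iUnion.1 hbd
    rw [edgeSet_eq_segment] at hj
    by_cases hji : j = i
    · subst hji
      exact hv t ht0 hj
    · exact ht j hji hj
  have hlim : ∀ (F : Filter ℝ) [F.NeBot] (c : ℝ), F ≤ 𝓝[≠] 0 →
      Tendsto (fun t : ℝ => viewAngle (P i) (P (finRotate n i)) (m + t • v)) F (𝓝 c) →
      c + rest m = 0 := by
    intro F _ c hF hc
    have hF0 : F ≤ 𝓝 0 := hF.trans nhdsWithin_le_nhds
    refine tendsto_nhds_unique (hc.add (hrestc.mono_left hF0)) ?_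
    refine tendsto_const_nhds.congr' ?_
    filter_upwards [hF0 hoff, hF self_mem_nhdsWithin] with t ht ht0
    rw [← hsplit, hout _ (ht ht0)]
  have h1 := hlim _ _ (nhdsGT_le_nhdsNE 0) hpos
  have h2 := hlim _ _ (nhdsLT_le_nhdsNE 0) hneg
  linarith [Real.pi_pos]

/-! ### Vertices visible from a point inside -/

lemma IsSimplePolygon.exists_eq_vertex (hP : IsSimplePolygon P) {i j : Fin n} (hij : i ≠ j)
    {z : Plane} (hi : z ∈ P.edgeSet ℝ i) (hj : z ∈ P.edgeSet ℝ j) : ∃ k, z = P k := by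
  by_cases h1 : j = finRotate n i
  · have : z ∈ P.edgeSet ℝ i ∩ P.edgeSet ℝ (finRotate n i) := ⟨hi, h1 ▸ hj⟩
    rw [hP.consecutive] at this
    exact ⟨_, this⟩
  by_cases h2 : i = finRotate n j
  · have : z ∈ P.edgeSet ℝ j ∩ P.edgeSet ℝ (finRotate n j) := ⟨hj, h2 ▸ hi⟩
    rw [hP.consecutive] at this
    exact ⟨_, this⟩
  · exact absurd hj (disjoint_left.1 (hP.nonconsecutive i j hij h1 h2) hi)

/-- Each vertex lies on an edge other than a given one. -/
lemma IsSimplePolygon.exists_ne_mem_edgeSet (hP : IsSimplePolygon P) (i k : Fin n) :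
    ∃ g, g ≠ i ∧ P k ∈ P.edgeSet ℝ g := by
  by_cases h : k = i
  · subst h
    obtain ⟨g, rfl⟩ := (finRotate n).surjective k
    exact ⟨g, (hP.finRotate_ne g).symm, right_mem_edgeSet P g⟩
  · exact ⟨k, h, left_mem_edgeSet P k⟩

/-- Every ray from a point inside hits the polygon. -/
lemma exists_add_smul_mem_boundary {p u : Plane} (hp : p ∈ inside P) (hu : u ≠ 0) :
    ∃ s : ℝ, 0 ≤ s ∧ p + s • u ∈ P.boundary ℝ := by
  by_contra! hcon
  have hsub : (fun s : ℝ => p + s • u) '' Ici 0 ⊆ connectedComponentIn (P.boundary ℝ)ᶜ p := by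
    apply IsPreconnected.subset_connectedComponentIn
    · exact (convex_Ici (0 : ℝ)).isPreconnected.image _ (by fun_prop)
    · exact ⟨0, self_mem_Ici, by simp⟩
    · rintro _ ⟨s, hs, rfl⟩
      exact hcon s hs
  obtain ⟨C, hC⟩ := (hp.2.subset hsub).exists_norm_le
  have hu' : 0 < ‖u‖ := norm_pos_iff.2 hu
  set s := (|C| + ‖p‖ + 1) / ‖u‖ with hs
  have hs0 : 0 ≤ s := by positivity
  have h1 := hC _ ⟨s, hs0, rfl⟩
  have h2 : ‖s • u‖ ≤ ‖p + s • u‖ + ‖p‖ := by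
    calc ‖s • u‖ = ‖(p + s • u) - p‖ := by congr 1; module
      _ ≤ _ := norm_sub_le _ _
  rw [norm_smul, Real.norm_of_nonneg hs0, hs, div_mul_cancel₀ _ hu'.ne'] at h2
  dsimp only at h1
  rw [hs] at h1
  linarith [le_abs_self C]

/-- Every open half-plane whose boundary line contains a point `p` inside the polygon contains a
vertex visible from `p`. If the first point `x` of the polygon in some direction is not a vertex, its
edge has an endpoint `s` in the half-plane. Among the points of the other edges in the triangle
`p x s`, take one at the smallest angle from `x`, and among these one nearest to `p`: since a point
inside an edge could be moved along the edge, it is a vertex. -/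
theorem exists_visible_vertex (hP : IsSimplePolygon P) {p : Plane} (hp : p ∈ inside P)
    (f : Plane →ₗ[ℝ] ℝ) (hf : ∃ u, 0 < f u) :
    ∃ k, f p < f (P k) ∧ P.boundary ℝ ∩ segment ℝ p (P k) ⊆ {P k} := by
  obtain ⟨u, hu⟩ := hf
  have hu0 : u ≠ 0 := by rintro rfl; simp at hu
  have hB : IsClosed (P.boundary ℝ) := (isCompact_boundary P).isClosed
  have hpB := hp.1
  -- the first point `x` of the polygon in direction `u`
  obtain ⟨x, hxB, hfx, hxvis⟩ : ∃ x ∈ P.boundary ℝ, f p < f x ∧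
      P.boundary ℝ ∩ segment ℝ p x ⊆ {x} := by
    set R : Set ℝ := {s | 0 ≤ s ∧ p + s • u ∈ P.boundary ℝ}
    have hRc : IsClosed R :=
      isClosed_Ici.inter (hB.preimage (show Continuous fun s : ℝ => p + s • u by fun_prop))
    have hRb : BddBelow R := ⟨0, fun s hs => hs.1⟩
    obtain ⟨h0, hmem⟩ := hRc.csInf_mem (exists_add_smul_mem_boundary hp hu0) hRb
    set s := sInf R with hs
    have hspos : 0 < s := lt_of_le_of_ne h0 (fun h => hpB (by rw [← h] at hmem; simpa using hmem))
    refine ⟨p + s • u, hmem, ?_, ?_⟩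
    · rw [map_add, map_smul, smul_eq_mul]
      have := mul_pos hspos hu
      linarith
    · rintro y ⟨hy, hy'⟩
      obtain ⟨t, ht0, ht1, rfl⟩ := mem_segment_iff_exists_smul_sub.1 hy'
      have h1 : t * s ∈ R := by
        refine ⟨by positivity, ?_⟩
        convert hy using 1
        module
      have h2 := csInf_le hRb h1
      have : t = 1 := le_antisymm ht1 (by nlinarith)
      rw [mem_singleton_iff, this]
      module
  by_cases hxv : ∃ k, x = P k
  · obtain ⟨k, rfl⟩ := hxv
    exact ⟨k, hfx, hxvis⟩
  -- the endpoint `P j` of the edge of `x` in the half-plane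
  obtain ⟨i, hi⟩ := mem_iUnion.1 hxB
  obtain ⟨j, j', hedge, hfj⟩ : ∃ j j', P.edgeSet ℝ i = segment ℝ (P j') (P j) ∧ f p < f (P j) := by
    have hi' := hi
    rw [edgeSet_eq_segment] at hi'
    obtain ⟨t, ht0, ht1, e⟩ := mem_segment_iff_exists_smul_sub.1 hi'
    by_cases h : f p < f (P i)
    · exact ⟨i, finRotate n i, by rw [segment_symm]; exact edgeSet_eq_segment P i, h⟩
    · refine ⟨finRotate n i, i, edgeSet_eq_segment P i, ?_⟩
      by_contra h'
      have : f x = (1 - t) * f (P i) + t * f (P (finRotate n i)) := by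
        rw [e, map_add, map_smul, map_sub, smul_eq_mul]
        ring
      nlinarith
  set s := P j
  have hsB : s ∈ P.boundary ℝ := vertex_mem_boundary P j
  rw [hedge] at hi
  obtain ⟨c, hc0, hc1, hxc⟩ := mem_segment_iff_exists_smul_sub.1 hi
  have hc0' : 0 < c := lt_of_le_of_ne hc0 (by
    rintro rfl; exact hxv ⟨j', by rw [hxc]; module⟩)
  have hc1' : c < 1 := lt_of_le_of_ne hc1 (by
    rintro rfl; exact hxv ⟨j, by rw [hxc]; module⟩)
  have hedgeB : segment ℝ (P j') s ⊆ P.boundary ℝ := hedge ▸ edgeSet_subset_boundary P i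
  have hX : x - p ≠ 0 := by
    intro h
    rw [sub_eq_zero.1 h] at hfx
    exact lt_irrefl _ hfx
  -- `x - p` and `s - p` form a basis
  rcases eq_smul_or_basis (x - p) (s - p) hX with ⟨k, hk⟩ | ⟨hbas, hind⟩
  · exfalso
    have hfk : f s - f p = k * (f x - f p) := by
      rw [← map_sub, hk, map_smul, map_sub, smul_eq_mul]
    have hk0 : 0 < k := by
      by_contra h
      nlinarith
    have hxs : x ≠ s := fun h => hxv ⟨j, h⟩
    have hk1 : 1 < k := by
      by_contra h
      refine hxs (hxvis ⟨hsB, mem_segment_iff_exists_smul_sub.2 ⟨k, hk0.le, not_lt.1 h, ?_⟩⟩).symm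
      rw [← hk, add_sub_cancel]
    -- the other endpoint
    have hj' : P j' = p + ((1 - c * k) / (1 - c)) • (x - p) := by
      have h1c : (1 - c) ≠ 0 := by linarith
      have : (1 - c) • (P j' - p) = (1 - c * k) • (x - p) := by
        linear_combination (norm := module) -hxc - c • hk
      rw [div_eq_inv_mul, mul_smul, ← this, smul_smul, inv_mul_cancel₀ h1c, one_smul,
        add_sub_cancel]
    set k' := (1 - c * k) / (1 - c) with hk'
    have hk'1 : k' ≤ 1 := by
      rw [hk', div_le_one (by linarith)]
      nlinarith
    rcases le_total 0 k' with h | h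
    · refine hxv ⟨j', (hxvis ⟨vertex_mem_boundary P j',
        mem_segment_iff_exists_smul_sub.2 ⟨k', h, hk'1, hj'⟩⟩).symm⟩
    · have hkk : 0 < k - k' := by linarith
      refine hpB (hedgeB (mem_segment_iff_exists_smul_sub.2 ⟨-k' / (k - k'),
        div_nonneg (by linarith) hkk.le, by rw [div_le_one hkk]; linarith, ?_⟩))
      have h1 : s - P j' = (k - k') • (x - p) := by
        rw [hj']
        linear_combination (norm := module) hk
      rw [h1, smul_smul, div_mul_cancel₀ _ hkk.ne', hj']
      module
  have huniq : ∀ a b a' b' : ℝ, a • (x - p) + b • (s - p) = a' • (x - p) + b' • (s - p) →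
      a = a' ∧ b = b' := fun a b a' b' e => by
    have := hind (a - a') (b - b') (by linear_combination (norm := module) e)
    exact ⟨by linarith [this.1], by linarith [this.2]⟩
  -- points of the edge of `x` have coordinates with sum `1`
  have hline : ∀ y ∈ segment ℝ (P j') s, ∃ q : ℝ, y = p + ((1 - q) • (x - p) + q • (s - p)) := by
    intro y hy
    obtain ⟨r, -, -, rfl⟩ := mem_segment_iff_exists_smul_sub.1 hy
    have h1c : (1 - c) ≠ 0 := by linarith
    refine ⟨(r - c) / (1 - c), ?_⟩
    have h2 : (1 - c) • (s - P j') = s - x := by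
      rw [hxc]
      module
    have h3 : s - P j' = (1 - c)⁻¹ • (s - x) := by
      rw [← h2, smul_smul, inv_mul_cancel₀ h1c, one_smul]
    have h4 : P j' = x - c • (s - P j') := by
      rw [hxc]
      module
    rw [show P j' + r • (s - P j') = x + (r - c) • (s - P j') by
      linear_combination (norm := module) h4, h3, smul_smul, ← div_eq_mul_inv]
    module
  set F : Set Plane := ⋃ (g) (_ : g ≠ i), P.edgeSet ℝ g
  have hFc : IsClosed F := by
    refine isClosed_iUnion_of_finite fun g => isClosed_iUnion_of_finite fun _ => ?_
    rw [edgeSet_eq_segment]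
    exact isClosed_segment _ _
  have hFB : F ⊆ P.boundary ℝ := iUnion₂_subset fun g _ => edgeSet_subset_boundary P g
  have hFv : ∀ y ∈ F, y ∈ segment ℝ (P j') s → ∃ k, y = P k := by
    intro y hy hy'
    obtain ⟨g, hg, hyg⟩ := mem_iUnion₂.1 hy
    exact hP.exists_eq_vertex hg hyg (hedge ▸ hy')
  have hBF : ∀ y ∈ P.boundary ℝ, y ∈ F ∨ y ∈ segment ℝ (P j') s := by
    intro y hy
    obtain ⟨g, hg⟩ := mem_iUnion.1 hy
    by_cases h : g = i
    · subst h
      exact Or.inr (hedge ▸ hg)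
    · exact Or.inl (mem_iUnion₂.2 ⟨g, h, hg⟩)
  -- coordinates of the points of the other edges in the triangle `p x s`
  set pt : ℝ × ℝ → Plane := fun w => p + (w.1 • (x - p) + w.2 • (s - p)) with hpt
  have hptc : Continuous pt := by fun_prop
  set D : Set (ℝ × ℝ) := {w | 0 ≤ w.1 ∧ 0 ≤ w.2 ∧ w.1 + w.2 ≤ 1 ∧ pt w ∈ F}
  have hDc : IsCompact D := by
    have h1 : IsClosed D := by
      refine (isClosed_le continuous_const continuous_fst).inter
        ((isClosed_le continuous_const continuous_snd).inter
          ((isClosed_le (continuous_fst.add continuous_snd) continuous_const).inter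
            (hFc.preimage hptc)))
    refine (isCompact_Icc (a := ((0 : ℝ), (0 : ℝ))) (b := (1, 1))).of_isClosed_subset h1 ?_
    rintro ⟨a, b⟩ ⟨h1, h2, h3, -⟩
    dsimp only at h1 h2 h3
    exact ⟨⟨h1, h2⟩, ⟨by dsimp only; linarith, by dsimp only; linarith⟩⟩
  have hDs : ((0 : ℝ), (1 : ℝ)) ∈ D := by
    refine ⟨le_rfl, zero_le_one, by simp, ?_⟩
    obtain ⟨g, hg, hgs⟩ := hP.exists_ne_mem_edgeSet i j
    have : pt (0, 1) = s := by
      simp only [hpt]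
      module
    rw [this]
    exact mem_iUnion₂.2 ⟨g, hg, hgs⟩
  have hDpos : ∀ w ∈ D, 0 < w.1 + w.2 := by
    rintro ⟨a, b⟩ ⟨h1, h2, -, h4⟩
    dsimp only at h1 h2 h4 ⊢
    by_contra h
    have ha : a = 0 := by linarith
    have hb : b = 0 := by linarith
    refine hpB (hFB ?_)
    simpa [hpt, ha, hb] using h4
  obtain ⟨w₁, hw₁, hmin₁⟩ := hDc.exists_isMinOn ⟨_, hDs⟩
    (f := fun w : ℝ × ℝ => w.2 / (w.1 + w.2))
    (continuousOn_snd.div (continuousOn_fst.add continuousOn_snd) fun w hw => (hDpos w hw).ne')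
  set τ := w₁.2 / (w₁.1 + w₁.2) with hτ
  have hτmin : ∀ w ∈ D, τ * (w.1 + w.2) ≤ w.2 := fun w hw => by
    have := hmin₁ hw
    rw [mem_ofPred_eq] at this
    exact (le_div_iff₀ (hDpos w hw)).1 this
  have hτ1 : τ ≤ 1 := by
    rw [hτ, div_le_one (hDpos _ hw₁)]
    linarith [hw₁.1]
  have hDc' : IsCompact (D ∩ {w | w.2 = τ * (w.1 + w.2)}) :=
    hDc.inter_right (isClosed_eq continuous_snd (by fun_prop))
  obtain ⟨⟨a, b⟩, ⟨hwD, hwτ⟩, hmin₂⟩ := hDc'.exists_isMinOn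
    ⟨w₁, hw₁, by
      rw [mem_ofPred_eq, hτ, div_mul_cancel₀ _ (hDpos _ hw₁).ne']⟩
    (f := fun w : ℝ × ℝ => w.1 + w.2) (by fun_prop)
  have hsum : ∀ w ∈ D, w.2 = τ * (w.1 + w.2) → a + b ≤ w.1 + w.2 := fun w hw h => hmin₂ ⟨hw, h⟩
  have hab := hDpos _ hwD
  obtain ⟨ha, hb, hab1, hzF⟩ := hwD
  rw [mem_ofPred_eq] at hwτ
  dsimp only at ha hb hab1 hwτ hab
  set z := pt (a, b) with hz
  have hzeq : z = p + (a • (x - p) + b • (s - p)) := rfl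
  have hb0 : 0 < b := by
    refine lt_of_le_of_ne hb fun h => ?_
    have hzx : z = x := by
      refine hxvis ⟨hFB hzF, mem_segment_iff_exists_smul_sub.2 ⟨a, ha, by linarith, ?_⟩⟩
      rw [hzeq, ← h, zero_smul, add_zero]
    exact hxv (hzx ▸ hFv z hzF (hzx ▸ hi))
  -- the chosen point is a vertex
  obtain ⟨k, hk⟩ : ∃ k, z = P k := by
    rcases hab1.eq_or_lt with h1 | h1
    · refine hFv z hzF ?_
      refine (convex_segment (P j') s).segment_subset hi (right_mem_segment ℝ _ _) ?_
      refine mem_segment_iff_exists_smul_sub.2 ⟨b, hb, by linarith, ?_⟩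
      rw [hzeq, show a = 1 - b by linarith]
      module
    by_contra hzv
    obtain ⟨g, hg, hzg⟩ := mem_iUnion₂.1 hzF
    have hzg' := hzg
    rw [edgeSet_eq_segment] at hzg'
    obtain ⟨t, ht0, ht1, hzt⟩ := mem_segment_iff_exists_smul_sub.1 hzg'
    set c₁ := P g
    set c₂ := P (finRotate n g)
    have ht0' : 0 < t := lt_of_le_of_ne ht0 (by
      rintro rfl; exact hzv ⟨g, by rw [hzt]; module⟩)
    have ht1' : t < 1 := lt_of_le_of_ne ht1 (by
      rintro rfl; exact hzv ⟨finRotate n g, by rw [hzt]; module⟩)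
    obtain ⟨ξ, η, hd⟩ := hbas (c₂ - c₁)
    -- small moves along the edge
    have hev : ∀ᶠ δ : ℝ in 𝓝 0, 0 < t + δ ∧ t + δ < 1 ∧ 0 < b + δ * η ∧
        a + b + δ * (ξ + η) < 1 ∧ 0 < a + b + δ * (ξ + η) := by
      have key : ∀ r q : ℝ, Tendsto (fun δ : ℝ => r + δ * q) (𝓝 0) (𝓝 r) := fun r q => by
        have hc : Continuous fun δ : ℝ => r + δ * q := by fun_prop
        simpa using hc.tendsto 0
      have key1 := key t 1
      simp only [mul_one] at key1
      filter_upwards [key1.eventually_const_lt ht0', key1.eventually_lt_const ht1',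
        (key b η).eventually_const_lt hb0, (key (a + b) (ξ + η)).eventually_lt_const h1,
        (key (a + b) (ξ + η)).eventually_const_lt hab] with δ h1 h2 h3 h4 h5
      exact ⟨h1, h2, h3, h4, h5⟩
    obtain ⟨ε, hε, hball⟩ := Metric.eventually_nhds_iff.1 hev
    have hmove : ∀ δ : ℝ, 0 ≤ a + δ * ξ → 0 < t + δ ∧ t + δ < 1 ∧ 0 < b + δ * η ∧
        a + b + δ * (ξ + η) < 1 ∧ 0 < a + b + δ * (ξ + η) → (a + δ * ξ, b + δ * η) ∈ D := by
      rintro δ ha' ⟨h1, h2, h3, h4, -⟩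
      refine ⟨ha', h3.le, by dsimp only; linarith, mem_iUnion₂.2 ⟨g, hg, ?_⟩⟩
      rw [edgeSet_eq_segment]
      refine mem_segment_iff_exists_smul_sub.2 ⟨t + δ, h1.le, h2.le, ?_⟩
      have : pt (a + δ * ξ, b + δ * η) = z + δ • (ξ • (x - p) + η • (s - p)) := by
        simp only [hz, hpt]
        module
      rw [this, ← hd, hzt]
      module
    have hsign : ∀ κ : ℝ, κ ≠ 0 → ∃ δ : ℝ, dist δ 0 < ε ∧ δ * κ < 0 := by
      intro κ hκ
      rcases hκ.lt_or_gt with h | h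
      · exact ⟨ε / 2, by rw [Real.dist_eq, sub_zero, abs_of_pos (by positivity)]; linarith,
          mul_neg_of_pos_of_neg (by positivity) h⟩
      · exact ⟨-(ε / 2), by
          rw [Real.dist_eq, sub_zero, abs_neg, abs_of_pos (by positivity)]; linarith,
          mul_neg_of_neg_of_pos (by linarith) h⟩
    by_cases hκ : η - τ * (ξ + η) = 0
    · -- the edge points to `p`: move towards `p`
      have hκ' : ξ + η ≠ 0 := by
        intro h
        rw [h, mul_zero, sub_zero] at hκ
        rw [hκ, add_zero] at h
        rw [h, hκ, zero_smul, zero_smul, add_zero, sub_eq_zero] at hd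
        exact hP.finRotate_ne g (hP.injective hd)
      obtain ⟨δ, hδ, hneg⟩ := hsign _ hκ'
      have hδ' := hball hδ
      have hτeq : b + δ * η = τ * (a + b + δ * (ξ + η)) := by
        linear_combination hwτ + δ * hκ
      have ha' : 0 ≤ a + δ * ξ := by
        have := mul_nonneg (sub_nonneg.2 hτ1) hδ'.2.2.2.2.le
        linarith
      have := hsum _ (hmove δ ha' hδ') (by dsimp only; linear_combination hτeq)
      dsimp only at this
      linarith
    · -- otherwise move towards a smaller angle
      obtain ⟨δ, hδ, hneg⟩ := hsign _ hκ
      have hδ' := hball hδ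
      have hτlt : b + δ * η < τ * (a + b + δ * (ξ + η)) := by linarith
      have ha' : 0 ≤ a + δ * ξ := by
        have := mul_nonneg (sub_nonneg.2 hτ1) hδ'.2.2.2.2.le
        linarith
      have := hτmin _ (hmove δ ha' hδ')
      dsimp only at this
      linarith
  refine ⟨k, ?_, ?_⟩
  · rw [← hk, hzeq, map_add, map_add, map_smul, map_smul, map_sub, map_sub, smul_eq_mul,
      smul_eq_mul]
    nlinarith [mul_nonneg ha (sub_nonneg.2 hfx.le), mul_pos hb0 (sub_pos.2 hfj)]
  · rw [← hk]
    rintro y ⟨hyB, hy⟩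
    obtain ⟨t, ht0, ht1, hyt⟩ := mem_segment_iff_exists_smul_sub.1 hy
    have hyc : y = pt (t * a, t * b) := by
      rw [hyt, hzeq]
      simp only [hpt]
      module
    have ht : t = 1 := by
      rcases hBF y hyB with h | h
      · have hmem : (t * a, t * b) ∈ D :=
          ⟨mul_nonneg ht0 ha, mul_nonneg ht0 hb, by dsimp only; nlinarith, hyc ▸ h⟩
        have := hsum _ hmem (by dsimp only; linear_combination t * hwτ)
        dsimp only at this
        nlinarith
      · obtain ⟨q, hq⟩ := hline y h
        rw [hyc] at hq
        obtain ⟨e1, e2⟩ := huniq _ _ _ _ (add_left_cancel hq)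
        nlinarith
    rw [mem_singleton_iff, hyt, ht, one_smul, add_sub_cancel]

/-- The linear functional that vanishes in direction `v` and is positive to the left of it. -/
def crossWith (v : Plane) : Plane →ₗ[ℝ] ℝ where
  toFun w := v 0 * w 1 - v 1 * w 0
  map_add' w w' := by simp; ring
  map_smul' c w := by simp; ring

lemma exists_crossWith_pos {v : Plane} (hv : v ≠ 0) :
    (∃ u, 0 < crossWith v u) ∧ ∃ u, 0 < (-crossWith v) u := by
  have hpos : 0 < v 0 * v 0 + v 1 * v 1 := by
    by_contra h
    apply hv
    ext i
    fin_cases i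
    · simp only [Fin.zero_eta, PiLp.zero_apply]
      nlinarith [mul_self_nonneg (v 0), mul_self_nonneg (v 1)]
    · simp only [Fin.mk_one, PiLp.zero_apply]
      nlinarith [mul_self_nonneg (v 0), mul_self_nonneg (v 1)]
  exact ⟨⟨!₂[-v 1, v 0], by simp [crossWith]; linarith⟩,
    ⟨!₂[v 1, -v 0], by simp [crossWith]; linarith⟩⟩

/-- A point inside a simple polygon sees three vertices. -/
theorem exists_three_visible (hP : IsSimplePolygon P) {p : Plane} (hp : p ∈ inside P) :
    ∃ S : Finset (Fin n), 3 ≤ S.card ∧ ∀ k ∈ S, P.boundary ℝ ∩ segment ℝ p (P k) ⊆ {P k} := by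
  have hv : !₂[(1 : ℝ), 0] ≠ (0 : Plane) := fun h => by
    have := congrArg (fun w : Plane => w 0) h
    simp at this
  obtain ⟨k₁, h₁, hk₁⟩ := exists_visible_vertex hP hp _ (exists_crossWith_pos hv).1
  have hv' : P k₁ - p ≠ 0 := by
    intro h
    rw [sub_eq_zero.1 h] at h₁
    exact lt_irrefl _ h₁
  obtain ⟨k₂, h₂, hk₂⟩ := exists_visible_vertex hP hp _ (exists_crossWith_pos hv').1
  obtain ⟨k₃, h₃, hk₃⟩ := exists_visible_vertex hP hp _ (exists_crossWith_pos hv').2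
  have h0 : crossWith (P k₁ - p) (P k₁) = crossWith (P k₁ - p) p := by
    rw [← sub_eq_zero, ← map_sub]
    simp only [crossWith, LinearMap.coe_mk, AddHom.coe_mk]
    ring
  rw [LinearMap.neg_apply, LinearMap.neg_apply, neg_lt_neg_iff] at h₃
  have h12 : k₁ ≠ k₂ := by rintro rfl; linarith
  have h13 : k₁ ≠ k₃ := by rintro rfl; linarith
  have h23 : k₂ ≠ k₃ := by rintro rfl; linarith
  refine ⟨{k₁, k₂, k₃}, (Finset.card_eq_three.2 ⟨k₁, k₂, k₃, h12, h13, h23, rfl⟩).ge, ?_⟩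
  intro k hk
  simp only [Finset.mem_insert, Finset.mem_singleton] at hk
  rcases hk with rfl | rfl | rfl
  · exact hk₁
  · exact hk₂
  · exact hk₃

/-! ### Extreme vertices -/

/-- The vertices of a simple polygon are not collinear: at the last vertex of a segment containing
them, two edges would overlap. -/
lemma IsSimplePolygon.not_subset_segment (hP : IsSimplePolygon P) (e₁ e₂ : Plane) :
    ¬ ∀ i, P i ∈ segment ℝ e₁ e₂ := by
  intro h
  choose t _ _ ht using fun i => mem_segment_iff_exists_smul_sub.1 (h i)
  have hn := hP.three_le
  have : Nonempty (Fin n) := ⟨⟨0, by omega⟩⟩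
  obtain ⟨i, hi⟩ := Finite.exists_max t
  obtain ⟨j, rfl⟩ := (finRotate n).surjective i
  have hmem : ∀ a b c : Fin n, t a ≤ t b → t b ≤ t c → P b ∈ segment ℝ (P a) (P c) := by
    intro a b c hab hbc
    rcases (hab.trans hbc).eq_or_lt with h | h
    · have : P b = P a := by rw [ht b, ht a, le_antisymm (hbc.trans h.ge) hab]
      rw [this]
      exact left_mem_segment ℝ _ _
    · have hac : 0 < t c - t a := sub_pos.2 h
      refine mem_segment_iff_exists_smul_sub.2 ⟨(t b - t a) / (t c - t a),
        div_nonneg (by linarith) hac.le, by rw [div_le_one hac]; linarith, ?_⟩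
      have e : (t b - t a) / (t c - t a) * (t c - t a) = t b - t a := div_mul_cancel₀ _ hac.ne'
      rw [ht a, ht b, ht c]
      linear_combination (norm := module) -e • (e₂ - e₁)
  have hinter := hP.consecutive j
  rw [edgeSet_eq_segment, edgeSet_eq_segment] at hinter
  rcases le_total (t j) (t (finRotate n (finRotate n j))) with h1 | h1
  · have h2 : P (finRotate n (finRotate n j)) ∈ ({P (finRotate n j)} : Set Plane) := by
      rw [← hinter]
      exact ⟨hmem _ _ _ h1 (hi _), right_mem_segment ℝ _ _⟩
    exact hP.finRotate_ne _ (hP.injective h2)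
  · have h2 : P j ∈ ({P (finRotate n j)} : Set Plane) := by
      rw [← hinter]
      refine ⟨left_mem_segment ℝ _ _, ?_⟩
      rw [segment_symm]
      exact hmem _ _ _ h1 (hi _)
    exact hP.finRotate_ne _ (hP.injective h2).symm

lemma exists_three_extreme (hP : IsSimplePolygon P) :
    ∃ S : Finset (Fin n), 3 ≤ S.card ∧
      ∀ k ∈ S, P k ∈ (convexHull ℝ (range P.vertices)).extremePoints ℝ := by
  classical
  set H := convexHull ℝ (range P.vertices)
  set S : Finset (Fin n) := Finset.univ.filter fun k => P k ∈ H.extremePoints ℝ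
  refine ⟨S, ?_, fun k hk => (Finset.mem_filter.1 hk).2⟩
  by_contra hcard
  obtain ⟨a, b, hab⟩ : ∃ a b : Fin n, S ⊆ {a, b} := by
    have hn := hP.three_le
    have h3 : S.card = 0 ∨ S.card = 1 ∨ S.card = 2 := by omega
    rcases h3 with h | h | h
    · exact ⟨⟨0, by omega⟩, ⟨0, by omega⟩, by rw [Finset.card_eq_zero.1 h]; simp⟩
    · obtain ⟨a, ha⟩ := Finset.card_eq_one.1 h
      exact ⟨a, a, by rw [ha]; simp⟩
    · obtain ⟨a, b, -, ha⟩ := Finset.card_eq_two.1 h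
      exact ⟨a, b, by rw [ha]⟩
  have hHc : IsCompact H := (finite_range P.vertices).isCompact_convexHull (𝕜 := ℝ)
  have hsub : H ⊆ segment ℝ (P a) (P b) := by
    rw [← closure_convexHull_extremePoints hHc (convex_convexHull ℝ _)]
    refine closure_minimal (convexHull_min ?_ (convex_segment _ _)) (isClosed_segment _ _)
    intro x hx
    obtain ⟨k, rfl⟩ := extremePoints_convexHull_subset hx
    have hk : k ∈ S := Finset.mem_filter.2 ⟨Finset.mem_univ _, hx⟩
    have := hab hk
    simp only [Finset.mem_insert, Finset.mem_singleton] at this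
    rcases this with rfl | rfl
    · exact left_mem_segment ℝ _ _
    · exact right_mem_segment ℝ _ _
  exact hP.not_subset_segment _ _ fun i => hsub (subset_convexHull ℝ _ (mem_range_self i))

/-- If `w` is an extreme point of a set containing `q`, then no point of the set lies behind `w` as
seen from `q`. -/
lemma ne_add_smul_of_mem_extremePoints {H : Set Plane} {q w z : Plane}
    (hw : w ∈ H.extremePoints ℝ) (hq : q ∈ H) (hz : z ∈ H) (hqw : q ≠ w) {s t : ℝ} (hs : 0 < s)
    (hst : s < t) : s • (z - q) ≠ t • (w - q) := by
  intro e
  have ht : 0 < t := hs.trans hst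
  have hmem : w ∈ openSegment ℝ q z := by
    rw [openSegment_eq_image']
    refine ⟨t⁻¹ * s, ⟨by positivity, ?_⟩, ?_⟩
    · rw [inv_mul_lt_iff₀ ht, mul_one]
      exact hst
    · dsimp only
      rw [mul_smul, e, smul_smul, inv_mul_cancel₀ ht.ne', one_smul, add_sub_cancel]
  rw [mem_extremePoints] at hw
  exact hqw (hw.2 q hq z hz hmem).1

/-- A centre in the convex hull from which the rays through three extreme vertices, continued behind
these vertices, are disjoint and avoid the polygon. -/
lemma exists_three_outward (hP : IsSimplePolygon P) :
    ∃ (q : Plane) (S : Finset (Fin n)), 3 ≤ S.card ∧ (∀ i, P i ≠ q) ∧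
      (∀ k ∈ S, P.boundary ℝ ∩ outwardRay q (P k) ⊆ {P k}) ∧
      ∀ k ∈ S, ∀ l ∈ S, k ≠ l → outwardRay q (P k) ∩ outwardRay q (P l) ⊆ ∅ := by
  obtain ⟨S, hS, hext⟩ := exists_three_extreme hP
  set H := convexHull ℝ (range P.vertices)
  have hPH : ∀ i, P i ∈ H := fun i => subset_convexHull ℝ _ (mem_range_self i)
  have hHconv : Convex ℝ H := convex_convexHull ℝ _
  have hBH : P.boundary ℝ ⊆ H := iUnion_subset fun i => by
    rw [edgeSet_eq_segment]
    exact hHconv.segment_subset (hPH _) (hPH _)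
  -- the centre: a point between two vertices that is not itself a vertex
  obtain ⟨q, hqH, hq⟩ : ∃ q ∈ H, ∀ i, P i ≠ q := by
    set i : Fin n := ⟨0, by have := hP.three_le; omega⟩
    have hne : P i ≠ P (finRotate n i) := fun h => hP.finRotate_ne i (hP.injective h).symm
    have hinj : Function.Injective (AffineMap.lineMap (P i) (P (finRotate n i)) : ℝ → Plane) :=
      AffineMap.lineMap_injective ℝ hne
    obtain ⟨q, ⟨t, ht, rfl⟩, hq⟩ := (((Ioo_infinite (zero_lt_one' ℝ)).image hinj.injOn).sdiff
      (finite_range P.vertices)).nonempty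
    refine ⟨_, hHconv.segment_subset (hPH i) (hPH (finRotate n i)) ?_, fun j h => hq ⟨j, h⟩⟩
    rw [segment_eq_image_lineMap]
    exact ⟨t, ⟨ht.1.le, ht.2.le⟩, rfl⟩
  refine ⟨q, S, hS, hq, ?_, ?_⟩
  · rintro k hk z ⟨hz, s, hs, rfl⟩
    rcases hs.eq_or_lt with rfl | h
    · rw [mem_singleton_iff]
      module
    · exact absurd (by module)
        (ne_add_smul_of_mem_extremePoints (hext k hk) hqH (hBH hz) (hq k).symm zero_lt_one h)
  · rintro k hk l hl hkl z ⟨⟨s, hs, rfl⟩, ⟨t, ht, e⟩⟩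
    have e' := add_left_cancel e
    rcases lt_trichotomy s t with h | h | h
    · exact ne_add_smul_of_mem_extremePoints (hext l hl) hqH (hPH k) (hq l).symm
        (by linarith) h e'
    · subst h
      have := smul_right_injective Plane (show s ≠ 0 by linarith) e'
      exact hkl (hP.injective (sub_left_injective this))
    · exact ne_add_smul_of_mem_extremePoints (hext k hk) hqH (hPH l) (hq k).symm
        (by linarith) h e'.symm

/-! ### Polylines inside and outside -/

lemma isPreconnected_segment_diff_left {a b : Plane} (hab : a ≠ b) :
    IsPreconnected (segment ℝ a b \ {a}) := by
  have : segment ℝ a b \ {a} = (fun t : ℝ => a + t • (b - a)) '' Ioc 0 1 := by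
    ext z
    constructor
    · rintro ⟨hz, hza⟩
      obtain ⟨t, h0, h1, rfl⟩ := mem_segment_iff_exists_smul_sub.1 hz
      refine ⟨t, ⟨lt_of_le_of_ne h0 ?_, h1⟩, rfl⟩
      rintro rfl
      exact hza (by simp)
    · rintro ⟨t, ⟨h0, h1⟩, rfl⟩
      refine ⟨mem_segment_iff_exists_smul_sub.2 ⟨t, h0.le, h1, rfl⟩, fun h => ?_⟩
      rw [mem_singleton_iff, add_eq_left, smul_eq_zero, sub_eq_zero] at h
      exact h.elim h0.ne' hab.symm
  rw [this]
  exact (convex_Ioc (0 : ℝ) 1).isPreconnected.image _ (by fun_prop)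

lemma isPreconnected_outwardRay (q y : Plane) : IsPreconnected (outwardRay q y) := by
  have : outwardRay q y = (fun s : ℝ => q + s • (y - q)) '' Ici 1 := by
    ext z
    exact ⟨fun ⟨s, hs, e⟩ => ⟨s, hs, e.symm⟩, fun ⟨s, hs, e⟩ => ⟨s, hs, e.symm⟩⟩
  rw [this]
  exact (convex_Ici (1 : ℝ)).isPreconnected.image _ (by fun_prop)

lemma isPreconnected_outwardRay_diff_left {q y : Plane} (hy : y ≠ q) :
    IsPreconnected (outwardRay q y \ {y}) := by
  have : outwardRay q y \ {y} = (fun s : ℝ => q + s • (y - q)) '' Ioi 1 := by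
    ext z
    constructor
    · rintro ⟨⟨s, hs, rfl⟩, hzy⟩
      refine ⟨s, lt_of_le_of_ne hs ?_, rfl⟩
      rintro rfl
      exact hzy (by simp)
    · rintro ⟨s, hs, rfl⟩
      rw [mem_Ioi] at hs
      refine ⟨⟨s, hs.le, rfl⟩, fun h => ?_⟩
      have h' : (s - 1) • (y - q) = 0 := by
        rw [mem_singleton_iff] at h
        linear_combination (norm := module) h
      rw [smul_eq_zero, sub_eq_zero, sub_eq_zero] at h'
      exact h'.elim hs.ne' hy
  rw [this]
  exact (convex_Ioi (1 : ℝ)).isPreconnected.image _ (by fun_prop)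

lemma not_isBounded_outwardRay {q y : Plane} (hy : y ≠ q) :
    ¬ Bornology.IsBounded (outwardRay q y) := by
  intro h
  obtain ⟨C, hC⟩ := h.exists_norm_le
  have hpos : 0 < ‖y - q‖ := norm_pos_iff.2 (sub_ne_zero.2 hy)
  set s := (|C| + ‖q‖ + 1) / ‖y - q‖ with hs
  have hs0 : 0 ≤ s := by positivity
  have h1 := hC _ ⟨1 + s, by linarith, rfl⟩
  have h2 : ‖(1 + s) • (y - q)‖ ≤ ‖q + (1 + s) • (y - q)‖ + ‖q‖ := by
    calc ‖(1 + s) • (y - q)‖ = ‖(q + (1 + s) • (y - q)) - q‖ := by congr 1; module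
      _ ≤ _ := norm_sub_le _ _
  rw [norm_smul, Real.norm_of_nonneg (by linarith), add_mul, hs, div_mul_cancel₀ _ hpos.ne'] at h2
  rw [hs] at h1
  linarith [le_abs_self C]

namespace Finish

variable {T : Finish}

lemma isPreconnected_path_diff_left
    (hT : ∀ b, IsPreconnected (T.tail b))
    (hT' : ∀ b, b ≠ T.center → IsPreconnected (T.tail b \ {b})) (l : List Plane) :
    ∀ a, T.IsSimplePath a l → IsPreconnected (T.path a l \ {a}) := by
  have hpath : ∀ (l : List Plane) (a : Plane), IsPreconnected (T.path a l) := by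
    intro l
    induction l with
    | nil => exact hT
    | cons b l ih =>
      exact fun a => IsPreconnected.union b (right_mem_segment ℝ a b) (left_mem_path b l)
        (convex_segment a b).isPreconnected (ih b)
  cases l with
  | nil => exact hT'
  | cons b l =>
    rintro a ⟨-, hab, hsub, -⟩
    have ha : a ∉ T.path b l := fun h => hab (hsub ⟨left_mem_segment ℝ a b, h⟩)
    have : T.path a (b :: l) \ {a} = (segment ℝ a b \ {a}) ∪ T.path b l := by
      change (segment ℝ a b ∪ T.path b l) \ {a} = _
      rw [union_sdiff_distrib, sdiff_singleton_eq_self ha]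
    rw [this]
    exact IsPreconnected.union b ⟨right_mem_segment ℝ a b, hab.symm⟩ (left_mem_path b l)
      (isPreconnected_segment_diff_left hab) (hpath l b)

lemma IsSimplePath.getLastD_ne_center {a : Plane} {l : List Plane} (h : T.IsSimplePath a l) :
    l.getLastD a ≠ T.center := by
  induction l generalizing a with
  | nil => exact h
  | cons b l ih =>
    rw [List.getLastD_cons]
    exact ih h.2.2.2

lemma tail_getLastD_subset_path (a : Plane) (l : List Plane) :
    T.tail (l.getLastD a) ⊆ T.path a l := by
  induction l generalizing a with
  | nil => exact subset_rfl
  | cons b l ih =>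
    rw [List.getLastD_cons]
    exact (ih b).trans subset_union_right

end Finish

lemma path_inwardFinish (p a : Plane) (l : List Plane) :
    (inwardFinish p).path a l = polyline a l p := by
  induction l generalizing a with
  | nil => rfl
  | cons b l ih => exact congrArg (segment ℝ a b ∪ ·) (ih b)

lemma path_outwardFinish (q a : Plane) (l : List Plane) :
    (outwardFinish q).path a l = infinitePolyline a l (l.getLastD a - q) := by
  induction l generalizing a with
  | nil =>
    change outwardRay q a = {x | ∃ t : ℝ, 0 ≤ t ∧ x = a + t • (a - q)}
    ext z
    constructor
    · rintro ⟨s, hs, rfl⟩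
      exact ⟨s - 1, by linarith, by module⟩
    · rintro ⟨t, ht, rfl⟩
      exact ⟨1 + t, by linarith, by module⟩
  | cons b l ih =>
    rw [List.getLastD_cons]
    exact congrArg (segment ℝ a b ∪ ·) (ih b)

lemma isOpen_inside (P : Polygon Plane n) : IsOpen (inside P) := by
  have hO : IsOpen (P.boundary ℝ)ᶜ := (isCompact_boundary P).isClosed.isOpen_compl
  rw [isOpen_iff_mem_nhds]
  rintro x ⟨hx, hb⟩
  filter_upwards [hO.connectedComponentIn.mem_nhds (mem_connectedComponentIn hx)] with y hy
  refine ⟨connectedComponentIn_subset _ _ hy, ?_⟩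
  rwa [← connectedComponentIn_eq hy]

lemma natCast_le_of_le_half {k h : ℕ} (hh : 3 ≤ h) (hk : k ≤ (h - 2) / 2) :
    (k : ℝ) ≤ ((h : ℝ) - 2) / 2 := by
  have h1 : k * 2 + 2 ≤ h := by omega
  have h2 : (k : ℝ) * 2 + 2 ≤ h := by exact_mod_cast h1
  linarith

theorem isPlanarStar (hP : IsSimplePolygon P) : IsPlanarStar P (((n : ℝ) - 2) / 2) := by
  refine ⟨inside P, isOpen_inside P, inside_nonempty hP, subset_rfl, fun p hp => ?_⟩
  obtain ⟨S, hS, hvis⟩ := exists_three_visible hP hp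
  have hcen : ∀ i, P i ≠ p := fun i h => hp.1 (h ▸ vertex_mem_boundary P i)
  have hpair : ∀ i ∈ S, ∀ j ∈ S, i ≠ j → segment ℝ (P i) p ∩ segment ℝ (P j) p ⊆ {p} := by
    -- of two visible vertices in the same direction the nearer one would hide the other
    have key : ∀ i j, P.boundary ℝ ∩ segment ℝ p (P i) ⊆ {P i} → i ≠ j → ∀ s t : ℝ, 0 < t →
        0 ≤ s → s ≤ t → s • (P i - p) ≠ t • (P j - p) := by
      intro i j hi hij s t ht hs hst e
      refine hij (hP.injective (hi ⟨vertex_mem_boundary P j,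
        mem_segment_iff_exists_smul_sub.2 ⟨t⁻¹ * s, by positivity, ?_, ?_⟩⟩)).symm
      · rw [inv_mul_le_iff₀ ht, mul_one]
        exact hst
      · rw [mul_smul, e, smul_smul, inv_mul_cancel₀ ht.ne', one_smul, add_sub_cancel]
    rintro i hi j hj hij z ⟨hz, hz'⟩
    rw [segment_symm] at hz hz'
    obtain ⟨s, hs, -, rfl⟩ := mem_segment_iff_exists_smul_sub.1 hz
    obtain ⟨t, ht, -, e⟩ := mem_segment_iff_exists_smul_sub.1 hz'
    have e' := add_left_cancel e
    by_contra hne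
    have hs0 : 0 < s := lt_of_le_of_ne hs (by rintro rfl; exact hne (by simp))
    have ht0 : 0 < t := lt_of_le_of_ne ht (by rintro rfl; exact hne (by rw [e]; simp))
    rcases le_total s t with h | h
    · exact key i j (hvis i hi) hij s t ht0 hs h e'
    · exact key j i (hvis j hj) hij.symm t s hs0 ht h e'.symm
  obtain ⟨bends, hD, hlen⟩ := Finish.exists_isDrawing_univ (T := inwardFinish p) hP hcen
    (disjoint_singleton_right.2 hp.1) S hS
    (fun i hi => by
      change P.boundary ℝ ∩ segment ℝ (P i) p ⊆ {P i}
      rw [segment_symm]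
      exact hvis i hi) hpair
  have hpmem : ∀ i, p ∈ (inwardFinish p).path (P i) (bends i) := fun i =>
    Finish.meet_subset_path _ _ rfl
  refine ⟨bends, fun i => natCast_le_of_le_half hP.three_le (hlen i), fun i => ?_, ?_⟩
  · rw [← path_inwardFinish]
    have hsub : (inwardFinish p).path (P i) (bends i) \ {P i} ⊆
        connectedComponentIn (P.boundary ℝ)ᶜ p := by
      apply IsPreconnected.subset_connectedComponentIn
      · refine Finish.isPreconnected_path_diff_left (fun b => (convex_segment b p).isPreconnected)
          (fun b hb => isPreconnected_segment_diff_left hb) _ _ (hD.isSimplePath i (mem_univ i))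
      · exact ⟨hpmem i, (hcen i).symm⟩
      · exact fun z hz hzB => hz.2 (hD.boundary_inter i (mem_univ i) ⟨hzB, hz.1⟩)
    intro z hz
    refine ⟨connectedComponentIn_subset _ _ (hsub hz), ?_⟩
    rw [← connectedComponentIn_eq (hsub hz)]
    exact hp.2
  · intro i j hij
    rw [← path_inwardFinish, ← path_inwardFinish]
    exact (hD.inter_subset i (mem_univ i) j (mem_univ j) hij).antisymm
      (singleton_subset_iff.2 ⟨hpmem i, hpmem j⟩)

theorem isPlanarOuterStar (hP : IsSimplePolygon P) :
    IsPlanarOuterStar P (((n : ℝ) - 2) / 2) := by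
  obtain ⟨q, S, hS, hcen, hbd, hpair⟩ := exists_three_outward hP
  obtain ⟨bends, hD, hlen⟩ := Finish.exists_isDrawing_univ (T := outwardFinish q) hP hcen
    (disjoint_empty _) S hS hbd hpair
  refine ⟨bends, fun i => (bends i).getLastD (P i) - q, fun i => ?_,
    fun i => natCast_le_of_le_half hP.three_le (hlen i), fun i => ?_, fun i j hij => ?_⟩
  · exact sub_ne_zero.2 (hD.isSimplePath i (mem_univ i)).getLastD_ne_center
  · rw [← path_outwardFinish]
    have hpre : IsPreconnected ((outwardFinish q).path (P i) (bends i) \ {P i}) :=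
      Finish.isPreconnected_path_diff_left (isPreconnected_outwardRay q)
        (fun b hb => isPreconnected_outwardRay_diff_left hb) _ _ (hD.isSimplePath i (mem_univ i))
    have hoff : (outwardFinish q).path (P i) (bends i) \ {P i} ⊆ (P.boundary ℝ)ᶜ :=
      fun z hz hzB => hz.2 (hD.boundary_inter i (mem_univ i) ⟨hzB, hz.1⟩)
    intro z hz
    refine ⟨hoff hz, fun hb => ?_⟩
    have h1 := (hb.subset (hpre.subset_connectedComponentIn hz hoff)).union
      (Bornology.isBounded_singleton (x := P i))
    refine not_isBounded_outwardRay (hD.isSimplePath i (mem_univ i)).getLastD_ne_center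
      (h1.subset ((Finish.tail_getLastD_subset_path (T := outwardFinish q) _ _).trans ?_))
    intro y hy
    by_cases h : y = P i
    · exact Or.inr h
    · exact Or.inl ⟨hy, h⟩
  · rw [← path_outwardFinish, ← path_outwardFinish, disjoint_iff_inter_eq_empty]
    exact subset_empty_iff.1 (hD.inter_subset i (mem_univ i) j (mem_univ j) hij)

end PlanarStar

theorem mainTheorem11 (h : ℕ) (P : Polygon PlanarStar.Plane h)
    (hP : PlanarStar.IsSimplePolygon P) :
    PlanarStar.IsPlanarStar P (((h : ℝ) - 2) / 2) ∧
      PlanarStar.IsPlanarOuterStar P (((h : ℝ) - 2) / 2) :=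
  ⟨PlanarStar.isPlanarStar hP, PlanarStar.isPlanarOuterStar hP⟩
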